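/- Let $n\ge 2$ be even and place $n$ qubits on a ring, with positions taken modulo $n$. Let $\mathrm{RQC}(n,l)$ be the ensemble of depth-$l$ brickwork circuits $C=L_l\cdots L_1$, where each layer is a tensor product of $n/2$ nearest-neighbour two-qubit gates. The odd-numbered layers $L_1,L_3,\dots$ pair the qubits as $(0,1),(2,3),\dots$, and the even-numbered layers $L_2,L_4,\dots$ pair them as $(1,2),(3,4),\dots,(n-1,0)$. All gates are independent and distributed according to the Haar measure on $\mathbb U(4)$. For a Pauli operator $\sigma_p\in\{I,X,Y,Z\}^{\otimes n}$ and $1\le l\le d$, let $|\psi\rangle=L_d\cdots L_1|0^n\rangle$ with $L_d\cdots L_1\sim\mathrm{RQC}(n,d)$, and let $|\psi_l\rangle=L_d\cdots L_{l+1}\,\sigma_p\,L_l\cdots L_1|0^n\rangle$ be the output of the same circuit with the error $\sigma_p$ inserted after layer $l$. Call $\sigma_p$ $k$-local if it acts as the identity outside some $k$ consecutive qubits of the ring. Then: 1. For every Pauli operator $\sigma_p$ and all $1\le l\le d$, both expectations below exist and $$\mathbb E\,|\langle\psi_l|\psi\rangle|^2=\mathbb E_{C\sim\mathrm{RQC}(n,l)}\left|\langle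 0^n|C^\dagger\sigma_p C|0^n\rangle\right|^2 .$$ 2. There is a universal constant $\Delta>0$ such that for every even $n\ge2$, every non-identity $3$-local Pauli operator $\sigma_p$ and every $l\ge1$, $$\mathbb E_{C\sim\mathrm{RQC}(n,l)}\left|\langle 0^n|C^\dagger\sigma_p C|0^n\rangle\right|^2\le e^{-\Delta l}+\frac1{2^n}.$$ 3. For every even $n\ge2$, every non-identity single-qubit Pauli error ($1$-local $\sigma_p$) and every $l\ge1$, $$\mathbb E_{C\sim\mathrm{RQC}(n,l)}\left|\langle 0^n|C^\dagger\sigma_p C|0^n\rangle\right|^2\le\frac4{15}\left(\frac45\right)^{2(l-1)}+\frac1{2^n+1}.$$ -/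

import Mathlib

open MeasureTheory
open scoped Matrix

noncomputable section

/-- The group `U(4)`, realised as the unitary matrices on two qubits. -/
abbrev Gate : Type := Matrix.unitaryGroup (Fin 2 × Fin 2) ℂ

instance Gate.instCompactSpace : CompactSpace Gate := by
  have hclosed : IsClosed (Matrix.unitaryGroup (Fin 2 × Fin 2) ℂ :
      Set (Matrix (Fin 2 × Fin 2) (Fin 2 × Fin 2) ℂ)) := by
    have h : (Matrix.unitaryGroup (Fin 2 × Fin 2) ℂ :
        Set (Matrix (Fin 2 × Fin 2) (Fin 2 × Fin 2) ℂ)) = {A | A * star A = 1} := by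
      ext A
      exact Matrix.mem_unitaryGroup_iff
    rw [h]
    exact isClosed_eq (continuous_id.mul continuous_star) continuous_const
  have hK : IsCompact (Set.pi Set.univ fun _ : Fin 2 × Fin 2 =>
      Set.pi Set.univ fun _ : Fin 2 × Fin 2 => Metric.closedBall (0 : ℂ) 1) :=
    isCompact_univ_pi fun _ => isCompact_univ_pi fun _ => isCompact_closedBall _ _
  refine isCompact_iff_compactSpace.mp (hK.of_isClosed_subset hclosed ?_)
  intro A hA i _ j _
  simpa using entry_norm_bound_of_unitary hA i j

instance Gate.instMeasurableSpace : MeasurableSpace Gate := borel Gate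

instance Gate.instBorelSpace : BorelSpace Gate := ⟨rfl⟩

/-- The Haar probability measure on `U(4)`. -/
def haarGate : Measure Gate := Measure.haarMeasure ⊤

instance haarGate.instIsProbabilityMeasure : IsProbabilityMeasure haarGate :=
  ⟨by simpa [haarGate] using Measure.haarMeasure_self (K₀ := (⊤ : TopologicalSpace.PositiveCompacts Gate))⟩

/-- Computational basis states of `n` qubits placed on a ring; the positions are added mod `n`. -/
abbrev Config (n : ℕ) : Type := ZMod n → Fin 2

/-- Operators on `n` qubits, as matrices in the computational basis. -/
abbrev Operator (n : ℕ) : Type := Matrix (Config n) (Config n) ℂ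

/-- The unitaries of a brickwork circuit of depth `l` on a ring of `n` qubits (`n` even), which has
`n / 2` two-qubit gates in each layer: `U t i` is gate `i` of layer `t`. -/
abbrev Gates (n l : ℕ) : Type := Fin l → Fin (n / 2) → Gate

/-- The first of the two adjacent qubits on which gate `i` of layer `t` acts; the second is
`gateQubit n t i + 1`. Layers `0, 2, 4, …` pair the qubits as `(0,1), (2,3), …` and layers
`1, 3, 5, …` pair them as `(1,2), (3,4), …, (n-1,0)`. -/
def gateQubit (n t : ℕ) (i : Fin (n / 2)) : ZMod n := ((2 * (i : ℕ) + t % 2 : ℕ) : ZMod n)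

/-- The operator of layer `t`: the tensor product of its two-qubit gates. -/
def layer (n t : ℕ) (U : Fin (n / 2) → Gate) : Operator n := fun x y =>
  ∏ i, (U i : Matrix (Fin 2 × Fin 2) (Fin 2 × Fin 2) ℂ)
    (x (gateQubit n t i), x (gateQubit n t i + 1)) (y (gateQubit n t i), y (gateQubit n t i + 1))

/-- The four single-qubit Pauli operators. -/
inductive Pauli : Type
  | I
  | X
  | Y
  | Z

/-- The matrix of a single-qubit Pauli operator. -/
def Pauli.toMatrix : Pauli → Matrix (Fin 2) (Fin 2) ℂ
  | .I => !![1, 0; 0, 1]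
  | .X => !![0, 1; 1, 0]
  | .Y => !![0, -Complex.I; Complex.I, 0]
  | .Z => !![1, 0; 0, -1]

/-- The `n`-qubit Pauli operator `σ_p = ⨂ₖ σ_{p k}`. -/
def pauliOperator (n : ℕ) [NeZero n] (p : ZMod n → Pauli) : Operator n := fun x y =>
  ∏ k, (p k).toMatrix (x k) (y k)

/-- `p` acts as the identity outside some `k` consecutive qubits of the ring. -/
def IsLocalPauli (k : ℕ) {n : ℕ} (p : ZMod n → Pauli) : Prop :=
  ∃ q : ZMod n, ∀ j : ZMod n, p j ≠ Pauli.I → ∃ i : ℕ, i < k ∧ j = q + (i : ZMod n)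

/-- The depth-`l` circuit `C = L_{l-1} ⋯ L_1 L_0`. -/
def circuit (n : ℕ) [NeZero n] : (l : ℕ) → Gates n l → Operator n
  | 0, _ => 1
  | l + 1, U => layer n l (U (Fin.last l)) * circuit n l (fun t => U t.castSucc)

/-- The depth-`d` circuit in which the error `σ_p` is inserted right after the first `l` layers
(for `1 ≤ l ≤ d`). -/
def erroneousCircuit (n : ℕ) [NeZero n] (p : ZMod n → Pauli) (l : ℕ) :
    (d : ℕ) → Gates n d → Operator n
  | 0, _ => 1
  | d + 1, U => (if d + 1 = l then pauliOperator n p else 1) *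
      (layer n d (U (Fin.last d)) * erroneousCircuit n p l d (fun t => U t.castSucc))

/-- The vector `A |0ⁿ⟩`. -/
def applyToZero {n : ℕ} (A : Operator n) : Config n → ℂ := fun x => A x 0

/-- The inner product `⟨φ|ψ⟩`, conjugate-linear in `φ`. -/
def braket {n : ℕ} [NeZero n] (φ ψ : Config n → ℂ) : ℂ := star φ ⬝ᵥ ψ

/-- The ensemble `RQC(n, l)`: all gates are independent and Haar distributed. -/
def rqc (n l : ℕ) : Measure (Gates n l) := Measure.pi fun _ => Measure.pi fun _ => haarGate

/-- `|⟨0ⁿ| C† σ_p C |0ⁿ⟩|²` for the depth-`l` circuit `C` with gates `U`. -/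
def pauliSq (n : ℕ) [NeZero n] (p : ZMod n → Pauli) (l : ℕ) (U : Gates n l) : ℝ :=
  ‖((circuit n l U)ᴴ * pauliOperator n p * circuit n l U) 0 0‖ ^ 2

/-- `|⟨ψ_l|ψ⟩|²`, where `ψ` is the output of the ideal depth-`d` circuit with gates `U` and `ψ_l`
is the output of the same circuit with the error `σ_p` after layer `l`. -/
def overlapSq (n : ℕ) [NeZero n] (p : ZMod n → Pauli) (d l : ℕ) (U : Gates n d) : ℝ :=
  ‖braket (applyToZero (erroneousCircuit n p l d U)) (applyToZero (circuit n d U))‖ ^ 2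

end

noncomputable section

open scoped Kronecker

/-! Layers after the error occur in both bra and ket and cancel by unitarity, which gives part 1.
For the bounds, `A = C† σ_p C` is Hermitian, so `|A 0 0|²` is the `(0, 0)` entry of `(C ⊗ C)† (σ_p ⊗
σ_p) (C ⊗ C)`, and averaging peels off layers one at a time from the end.

Averaging one gate projects its two-copy factor onto the span of the identity and the swap `S`
(`eq_smul_one_add_smul_swapOp`, `twirl_eq`). A nontrivial Pauli pair becomes `-1/15 + (4/15) S`. A
3-local error meets one gate of the last layer or two adjacent ones, so the mean is an affine
combination of mean purities of arcs of 2 or 4 qubits (`integral_pauliSq_one_gate`,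
`integral_pauliSq_two_gates`).

Each earlier layer cuts a nontrivial arc at both ends. A cut gate averages to `2/5 (1 + S)`, so each
end moves one site in or out with weight `2/5` (`pairAverage_succ_arc`). The Haar-state purity is a
fixed point of this recursion with the same boundary values. The weights sum to `16/25 = (4/5)²`, so
the deviation stays nonnegative and is at most `(16/25)^l` (`arcPurity_sub_haarPurity`). Applied to
the Haar purities, the same affine combinations equal `1 / (2^n + 1)`. -/

/-! ### The commutant of `V ⊗ V` -/

/-- The index set of the computational basis of two qubits. -/
abbrev TwoQubit : Type := Fin 2 × Fin 2

/-- Operators on two copies of a two-qubit system. -/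
abbrev PairOp : Type := Matrix (TwoQubit × TwoQubit) (TwoQubit × TwoQubit) ℂ

/-- The operator that exchanges the two copies. -/
def swapOp : PairOp := Matrix.of fun x y => if x = y.swap then 1 else 0

/-- Conjugation of an operator on two copies by `U† ⊗ U†`. -/
def conjPair {ι : Type*} [Fintype ι] (U : Matrix ι ι ℂ) (X : Matrix (ι × ι) (ι × ι) ℂ) :
    Matrix (ι × ι) (ι × ι) ℂ := (U ⊗ₖ U)ᴴ * X * (U ⊗ₖ U)

theorem conjPair_mul {ι : Type*} [Fintype ι] (U V : Matrix ι ι ℂ)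
    (X : Matrix (ι × ι) (ι × ι) ℂ) : conjPair (U * V) X = conjPair V (conjPair U X) := by
  simp only [conjPair, Matrix.mul_kronecker_mul, Matrix.conjTranspose_mul, Matrix.mul_assoc]

theorem conjPair_apply {ι : Type*} [Fintype ι] (U : Matrix ι ι ℂ)
    (X : Matrix (ι × ι) (ι × ι) ℂ) (a b : ι × ι) :
    conjPair U X a b = ∑ c, ∑ d, star (U c.1 a.1 * U c.2 a.2) * X c d * (U d.1 b.1 * U d.2 b.2) := by
  simp only [conjPair, Matrix.mul_apply, Matrix.conjTranspose_apply, Matrix.kroneckerMap_apply,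
    Finset.sum_mul]
  exact Finset.sum_comm

theorem conjPair_diagonal {ι : Type*} [Fintype ι] [DecidableEq ι] (d : ι → ℂ)
    (X : Matrix (ι × ι) (ι × ι) ℂ) (a b : ι × ι) :
    conjPair (Matrix.diagonal d) X a b =
      star (d a.1 * d a.2) * X a b * (d b.1 * d b.2) := by
  simp [conjPair, Matrix.diagonal_kronecker_diagonal, Matrix.diagonal_conjTranspose,
    Matrix.diagonal_mul, Matrix.mul_diagonal]

theorem conjPair_perm {ι : Type*} [Fintype ι] [DecidableEq ι] (π : Equiv.Perm ι)
    (X : Matrix (ι × ι) (ι × ι) ℂ) (a b : ι × ι) :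
    conjPair (Matrix.of fun i j => if i = π j then 1 else 0) X a b =
      X (π a.1, π a.2) (π b.1, π b.2) := by
  rw [conjPair_apply, Finset.sum_eq_single (π a.1, π a.2), Finset.sum_eq_single (π b.1, π b.2)]
  · simp
  · rintro ⟨c, d⟩ - h
    have : ¬ (c = π b.1 ∧ d = π b.2) := by simpa using h
    by_cases h1 : c = π b.1 <;> simp_all
  · simp
  · rintro ⟨c, d⟩ - h
    have : ¬ (c = π a.1 ∧ d = π a.2) := by simpa using h
    by_cases h1 : c = π a.1 <;> simp_all
  · simp

theorem permutation_mem_unitaryGroup {ι : Type*} [Fintype ι] [DecidableEq ι] (π : Equiv.Perm ι) :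
    (Matrix.of fun i j => if i = π j then 1 else 0 : Matrix ι ι ℂ) ∈ Matrix.unitaryGroup ι ℂ := by
  rw [Matrix.mem_unitaryGroup_iff']
  ext i j
  simp [Matrix.mul_apply, Matrix.star_apply, Matrix.one_apply, eq_comm]

theorem diagonal_mem_unitaryGroup {ι : Type*} [Fintype ι] [DecidableEq ι] (d : ι → ℂ)
    (hd : ∀ i, star (d i) * d i = 1) : Matrix.diagonal d ∈ Matrix.unitaryGroup ι ℂ := by
  rw [Matrix.mem_unitaryGroup_iff', Matrix.star_eq_conjTranspose, Matrix.diagonal_conjTranspose,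
    Matrix.diagonal_mul_diagonal, ← Matrix.diagonal_one]
  congr 1
  funext i
  simpa using hd i

/-- A qubitRotation of the first of two qubits. -/
def qubitRotation : Matrix TwoQubit TwoQubit ℂ :=
  (!![3 / 5, -4 / 5; 4 / 5, 3 / 5] : Matrix (Fin 2) (Fin 2) ℂ) ⊗ₖ (1 : Matrix (Fin 2) (Fin 2) ℂ)

theorem qubitRotation_mem_unitaryGroup : qubitRotation ∈ Matrix.unitaryGroup TwoQubit ℂ := by
  refine Matrix.kronecker_mem_unitary ?_ (one_mem _)
  rw [Matrix.mem_unitaryGroup_iff']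
  ext i j
  fin_cases i <;> fin_cases j <;>
    norm_num [Matrix.mul_apply, Fin.sum_univ_two, Matrix.star_apply, Complex.conj_ofNat]

/-- The left side is `i` to the power (number of true among `r, s`) minus (number of true among `p,
q`). This exponent lies in `[-2, 2]`, so the counts agree; "and" and "or" together encode a count.
-/
theorem phase_balance {p q r s : Prop} [Decidable p] [Decidable q] [Decidable r] [Decidable s]
    (h : star ((if p then Complex.I else 1) * (if q then Complex.I else 1)) *
      ((if r then Complex.I else 1) * (if s then Complex.I else 1)) = 1) :
    (p ∧ q ↔ r ∧ s) ∧ (p ∨ q ↔ r ∨ s) := by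
  by_cases p <;> by_cases q <;> by_cases r <;> by_cases s <;>
    simp_all [Complex.ext_iff] <;> norm_num at h

/-- Putting the phase `i` on a single basis state `g` shows that a nonzero entry has `g` equally
often in `a` and in `b`. Taking `g` to be each component of `a` makes `b` a rearrangement of `a`. -/
theorem apply_eq_zero_of_conjPair_eq {Y : PairOp}
    (hY : ∀ V ∈ Matrix.unitaryGroup TwoQubit ℂ, conjPair V Y = Y) {a b : TwoQubit × TwoQubit}
    (h1 : a ≠ b) (h2 : a ≠ b.swap) : Y a b = 0 := by
  obtain ⟨a, a'⟩ := a
  obtain ⟨b, b'⟩ := b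
  have key : ∀ g : TwoQubit, Y (a, a') (b, b') ≠ 0 →
      star ((if a = g then Complex.I else 1) * (if a' = g then Complex.I else 1)) *
        ((if b = g then Complex.I else 1) * (if b' = g then Complex.I else 1)) = 1 := by
    intro g h0
    have h := congrFun (congrFun (hY _ (diagonal_mem_unitaryGroup
      (fun x => if x = g then Complex.I else 1)
      (fun i => by split_ifs <;> simp))) (a, a')) (b, b')
    rw [conjPair_diagonal] at h
    apply mul_right_cancel₀ h0
    rw [one_mul]
    conv_rhs => rw [← h]
    ring
  by_contra h0
  have ha := phase_balance (key a h0)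
  have ha' := phase_balance (key a' h0)
  simp only [Prod.swap_prod_mk, ne_eq, Prod.mk.injEq] at h1 h2
  grind

/-- Schur–Weyl duality for two copies: an operator invariant under all `V ⊗ V` is a combination of
the identity and the swap. -/
theorem eq_smul_one_add_smul_swapOp {Y : PairOp}
    (hY : ∀ V ∈ Matrix.unitaryGroup TwoQubit ℂ, conjPair V Y = Y) :
    ∃ α β : ℂ, Y = α • (1 : PairOp) + β • swapOp := by
  have hperm : ∀ (π : Equiv.Perm TwoQubit) (a a' b b' : TwoQubit),
      Y (π a, π a') (π b, π b') = Y (a, a') (b, b') := by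
    intro π a a' b b'
    have h := congrFun (congrFun (hY _ (permutation_mem_unitaryGroup π)) (a, a')) (b, b')
    rwa [conjPair_perm] at h
  set a₀ : TwoQubit := (0, 0) with ha₀
  set b₀ : TwoQubit := (1, 0) with hb₀
  have hab : a₀ ≠ b₀ := by decide
  -- Permutations act doubly transitively on the basis, so only three parameters of `Y` survive.
  have hpair : ∀ a a' : TwoQubit, a ≠ a' → ∃ π : Equiv.Perm TwoQubit, π a = a₀ ∧ π a' = b₀ := by
    intro a a' h
    refine ⟨Equiv.swap (Equiv.swap a a₀ a') b₀ * Equiv.swap a a₀, ?_, ?_⟩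
    · rw [Equiv.Perm.mul_apply, Equiv.swap_apply_left]
      refine Equiv.swap_apply_of_ne_of_ne ?_ hab
      intro h'
      rw [eq_comm, Equiv.swap_apply_eq_iff, Equiv.swap_apply_right] at h'
      exact h h'.symm
    · rw [Equiv.Perm.mul_apply, Equiv.swap_apply_left]
  have hd : ∀ a a' : TwoQubit, a ≠ a' → Y (a, a') (a, a') = Y (a₀, b₀) (a₀, b₀) := by
    intro a a' h
    obtain ⟨π, h1, h2⟩ := hpair a a' h
    rw [← hperm π a a' a a', h1, h2]
  have he : ∀ a a' : TwoQubit, a ≠ a' → Y (a, a') (a', a) = Y (a₀, b₀) (b₀, a₀) := by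
    intro a a' h
    obtain ⟨π, h1, h2⟩ := hpair a a' h
    rw [← hperm π a a' a' a, h1, h2]
  have hc : ∀ a : TwoQubit, Y (a, a) (a, a) = Y (a₀, a₀) (a₀, a₀) := by
    intro a
    rw [← hperm (Equiv.swap a a₀) a a a a, Equiv.swap_apply_left]
  -- Permutations and phases cannot relate the three parameters; a rotation mixing `a₀` and `b₀`
  -- does. With cosine `3/5` and sine `4/5` the invariance reads `c = (337/625) c + (288/625) (d +
  -- e)`, whence the factor `625/288`.
  have hrot : Y (a₀, a₀) (a₀, a₀) = Y (a₀, b₀) (a₀, b₀) + Y (a₀, b₀) (b₀, a₀) := by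
    have h := congrFun (congrFun (hY _ qubitRotation_mem_unitaryGroup) (a₀, a₀)) (a₀, a₀)
    have z1 := apply_eq_zero_of_conjPair_eq hY (a := (a₀, a₀)) (b := (a₀, b₀)) (by decide) (by decide)
    have z2 := apply_eq_zero_of_conjPair_eq hY (a := (a₀, a₀)) (b := (b₀, a₀)) (by decide) (by decide)
    have z3 := apply_eq_zero_of_conjPair_eq hY (a := (a₀, a₀)) (b := (b₀, b₀)) (by decide) (by decide)
    have z4 := apply_eq_zero_of_conjPair_eq hY (b := (a₀, a₀)) (a := (a₀, b₀)) (by decide) (by decide)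
    have z5 := apply_eq_zero_of_conjPair_eq hY (b := (a₀, a₀)) (a := (b₀, a₀)) (by decide) (by decide)
    have z6 := apply_eq_zero_of_conjPair_eq hY (b := (a₀, a₀)) (a := (b₀, b₀)) (by decide) (by decide)
    have z7 := apply_eq_zero_of_conjPair_eq hY (a := (b₀, b₀)) (b := (a₀, b₀)) (by decide) (by decide)
    have z8 := apply_eq_zero_of_conjPair_eq hY (a := (b₀, b₀)) (b := (b₀, a₀)) (by decide) (by decide)
    have z9 := apply_eq_zero_of_conjPair_eq hY (b := (b₀, b₀)) (a := (a₀, b₀)) (by decide) (by decide)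
    have z10 := apply_eq_zero_of_conjPair_eq hY (b := (b₀, b₀)) (a := (b₀, a₀)) (by decide) (by decide)
    have e1 := he b₀ a₀ hab.symm
    have e2 := hd b₀ a₀ hab.symm
    have e3 := hc b₀
    rw [conjPair_apply] at h
    simp only [ha₀, hb₀] at *
    simp [Complex.conj_ofNat, Fintype.sum_prod_type, Fin.sum_univ_two, qubitRotation, Matrix.kroneckerMap_apply,
      z1, z2, z3, z4, z5, z6, z7, z8, z9, z10, e1, e2, e3] at h
    linear_combination (625 / 288 : ℂ) * (-h)
  refine ⟨Y (a₀, b₀) (a₀, b₀), Y (a₀, b₀) (b₀, a₀), ?_⟩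
  ext ⟨a, a'⟩ ⟨b, b'⟩
  simp only [Matrix.add_apply, Matrix.smul_apply, Matrix.one_apply, swapOp, Matrix.of_apply,
    Prod.swap_prod_mk,     smul_eq_mul]
  by_cases h1 : (a, a') = (b, b')
  · obtain ⟨rfl, rfl⟩ := Prod.mk.inj h1
    by_cases h : a = a'
    · subst h
      simp [hc, hrot]
    · simp [h, hd a a' h]
  · by_cases h2 : (a, a') = (b', b)
    · obtain ⟨rfl, rfl⟩ := Prod.mk.inj h2
      have h : a ≠ a' := by rintro rfl; exact h1 rfl
      simp [h, he a a' h]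
    · rw [if_neg h1, if_neg h2, apply_eq_zero_of_conjPair_eq hY h1 h2]
      simp

/-! ### Haar second moments on `U(4)` -/

instance Gate.instSecondCountableTopology : SecondCountableTopology Gate :=
  have : SecondCountableTopology (Matrix TwoQubit TwoQubit ℂ) :=
    inferInstanceAs (SecondCountableTopology (TwoQubit → TwoQubit → ℂ))
  Topology.IsInducing.subtypeVal.secondCountableTopology

instance haarGate.instIsHaarMeasure : Measure.IsHaarMeasure haarGate := by
  unfold haarGate
  infer_instance

/-- Unimodularity of a compact group: a right translate of Haar measure is again a Haar probability
measure, hence the same one. -/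
theorem map_mul_right_haarGate (V : Gate) : haarGate.map (· * V) = haarGate := by
  have : IsProbabilityMeasure (haarGate.map (· * V)) :=
    Measure.isProbabilityMeasure_map (measurable_mul_const V).aemeasurable
  exact Measure.isHaarMeasure_eq_of_isProbabilityMeasure _ _

instance haarGate.instIsMulRightInvariant : Measure.IsMulRightInvariant haarGate :=
  ⟨map_mul_right_haarGate⟩

theorem continuous_gate_apply (a b : TwoQubit) :
    Continuous fun U : Gate => (U : Matrix TwoQubit TwoQubit ℂ) a b :=
  (continuous_subtype_val.matrix_elem a b)

theorem continuous_conjPair_gate (X : PairOp) (a b : TwoQubit × TwoQubit) :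
    Continuous fun U : Gate => conjPair (U : Matrix TwoQubit TwoQubit ℂ) X a b := by
  simp only [conjPair_apply]
  refine continuous_finsetSum _ fun c _ => continuous_finsetSum _ fun d _ => ?_
  exact ((((continuous_gate_apply _ _).mul (continuous_gate_apply _ _)).star.mul
    continuous_const).mul ((continuous_gate_apply _ _).mul (continuous_gate_apply _ _)))

/-- A continuous function on a compact space is integrable for every finite measure. -/
theorem Continuous.integrable_of_compactSpace {X E : Type*} [TopologicalSpace X] [CompactSpace X]
    [MeasurableSpace X] [OpensMeasurableSpace X] [NormedAddCommGroup E] {μ : Measure X}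
    [IsFiniteMeasure μ] {f : X → E} (hf : Continuous f) : Integrable f μ :=
  hf.integrable_of_hasCompactSupport (HasCompactSupport.of_compactSpace f)

/-- The Haar average of `(U ⊗ U)† X (U ⊗ U)`. -/
def twirl (X : PairOp) : PairOp :=
  Matrix.of fun a b => ∫ U : Gate, conjPair (U : Matrix TwoQubit TwoQubit ℂ) X a b ∂haarGate

/-- Conjugating by `V` after `U` amounts to conjugating by `U * V`, and right invariance absorbs
`V`. -/
theorem conjPair_twirl (X : PairOp) (V : Matrix TwoQubit TwoQubit ℂ)
    (hV : V ∈ Matrix.unitaryGroup TwoQubit ℂ) : conjPair V (twirl X) = twirl X := by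
  ext a b
  have hint : ∀ c d, Integrable (fun U : Gate => star (V c.1 a.1 * V c.2 a.2) *
      conjPair (U : Matrix TwoQubit TwoQubit ℂ) X c d * (V d.1 b.1 * V d.2 b.2)) haarGate :=
    fun c d => (((continuous_conjPair_gate X c d).const_mul _).mul_const _).integrable_of_compactSpace
  calc conjPair V (twirl X) a b
      = ∑ c, ∑ d, ∫ U : Gate, star (V c.1 a.1 * V c.2 a.2) *
          conjPair (U : Matrix TwoQubit TwoQubit ℂ) X c d * (V d.1 b.1 * V d.2 b.2) ∂haarGate := by
        simp only [conjPair_apply V, twirl, Matrix.of_apply, integral_const_mul,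
          integral_mul_const]
    _ = ∫ U : Gate, conjPair V (conjPair (U : Matrix TwoQubit TwoQubit ℂ) X) a b ∂haarGate := by
        simp only [conjPair_apply V]
        rw [integral_finsetSum _ fun c _ => integrable_finsetSum _ fun d _ => hint c d]
        exact Finset.sum_congr rfl fun c _ => (integral_finsetSum _ fun d _ => hint c d).symm
    _ = ∫ U : Gate, conjPair ((U * (⟨V, hV⟩ : Gate) : Gate) : Matrix TwoQubit TwoQubit ℂ) X a b
          ∂haarGate := by
        simp only [← conjPair_mul]
        rfl
    _ = twirl X a b := by
        rw [integral_mul_right_eq_self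
          (fun U : Gate => conjPair (U : Matrix TwoQubit TwoQubit ℂ) X a b)]
        rfl

theorem swapOp_mul_apply (X : PairOp) (a b : TwoQubit × TwoQubit) :
    (swapOp * X) a b = X a.swap b := by
  rw [Matrix.mul_apply, Finset.sum_eq_single a.swap]
  · simp [swapOp]
  · intro c _ hc
    have : a ≠ c.swap := by rintro rfl; exact hc (by simp)
    simp [swapOp, this]
  · simp

theorem mul_swapOp_apply (X : PairOp) (a b : TwoQubit × TwoQubit) :
    (X * swapOp) a b = X a b.swap := by
  rw [Matrix.mul_apply, Finset.sum_eq_single b.swap]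
  · simp [swapOp]
  · intro c _ hc
    simp [swapOp, hc]
  · simp

theorem swapOp_mul_kronecker (U : Matrix TwoQubit TwoQubit ℂ) :
    swapOp * (U ⊗ₖ U) = (U ⊗ₖ U) * swapOp := by
  ext a b
  rw [swapOp_mul_apply, mul_swapOp_apply]
  simp [mul_comm]

theorem kronecker_mul_conjTranspose (U : Gate) :
    ((U : Matrix TwoQubit TwoQubit ℂ) ⊗ₖ (U : Matrix TwoQubit TwoQubit ℂ)) *
      ((U : Matrix TwoQubit TwoQubit ℂ) ⊗ₖ (U : Matrix TwoQubit TwoQubit ℂ))ᴴ = 1 := by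
  rw [Matrix.conjTranspose_kronecker, ← Matrix.mul_kronecker_mul,
    ← Matrix.star_eq_conjTranspose, Matrix.mem_unitaryGroup_iff.mp U.2, Matrix.one_kronecker_one]

theorem trace_conjPair (U : Gate) (X : PairOp) :
    (conjPair (U : Matrix TwoQubit TwoQubit ℂ) X).trace = X.trace := by
  rw [conjPair, Matrix.trace_mul_comm, ← Matrix.mul_assoc, kronecker_mul_conjTranspose, one_mul]

theorem swapOp_mul_conjPair (U : Matrix TwoQubit TwoQubit ℂ) (X : PairOp) :
    swapOp * conjPair U X = conjPair U (swapOp * X) := by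
  rw [conjPair, conjPair, Matrix.conjTranspose_kronecker, ← Matrix.mul_assoc, ← Matrix.mul_assoc,
    swapOp_mul_kronecker, Matrix.mul_assoc _ swapOp X]

theorem trace_twirl (X : PairOp) : (twirl X).trace = X.trace := by
  simp only [Matrix.trace, Matrix.diag_apply, twirl, Matrix.of_apply]
  rw [← integral_finsetSum _ fun a _ =>
    (continuous_conjPair_gate X a a).integrable_of_compactSpace]
  have h : ∀ U : Gate, ∑ a, conjPair (U : Matrix TwoQubit TwoQubit ℂ) X a a = ∑ a, X a a :=
    fun U => trace_conjPair U X
  simp [h]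

theorem swapOp_mul_twirl (X : PairOp) : swapOp * twirl X = twirl (swapOp * X) := by
  ext a b
  rw [swapOp_mul_apply]
  simp only [twirl, Matrix.of_apply, ← swapOp_mul_conjPair, swapOp_mul_apply]

/-- The second moment formula for the Haar measure on `U(4)`. -/
theorem twirl_eq (X : PairOp) :
    twirl X = ((4 * X.trace - (swapOp * X).trace) / 60) • (1 : PairOp) +
      ((4 * (swapOp * X).trace - X.trace) / 60) • swapOp := by
  -- The twirl preserves `tr X` and `tr (S X)`, because `S` commutes with `U ⊗ U`. The coefficients
  -- solve `16 α + 4 β = tr X` and `4 α + 16 β = tr (S X)`.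
  obtain ⟨α, β, h⟩ := eq_smul_one_add_smul_swapOp (conjPair_twirl X)
  have t1 : (1 : PairOp).trace = 16 := by simp [Matrix.trace_one]
  have t2 : swapOp.trace = 4 := by
    simp only [Matrix.trace, Matrix.diag_apply, swapOp, Matrix.of_apply]
    rw [Finset.sum_boole, show (Finset.univ.filter fun x : TwoQubit × TwoQubit => x = x.swap).card = 4
      by decide]
    norm_num
  have t3 : swapOp * swapOp = 1 := by
    ext a b
    rw [swapOp_mul_apply]
    simp [swapOp, Matrix.one_apply]
  have e1 := trace_twirl X
  have e2 : (swapOp * twirl X).trace = (swapOp * X).trace := by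
    rw [swapOp_mul_twirl, trace_twirl]
  rw [h, Matrix.trace_add, Matrix.trace_smul, Matrix.trace_smul, t1, t2] at e1
  rw [h, mul_add, mul_smul_comm, mul_smul_comm, t3, mul_one, Matrix.trace_add, Matrix.trace_smul,
    Matrix.trace_smul, t1, t2] at e2
  simp only [smul_eq_mul] at e1 e2
  rw [h, ← e1, ← e2]
  congr 2 <;> ring

/-! ### Tensor products along a decomposition of the index set -/

section Tensor

variable {α ι β : Type*}

/-- The decomposition of the indices of two copies of a system. -/
def pairEquiv (e : α ≃ (ι → β)) : α × α ≃ (ι → β × β) :=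
  (e.prodCongr e).trans (Equiv.arrowProdEquivProdArrow ι (fun _ => β) (fun _ => β)).symm

theorem pairEquiv_apply (e : α ≃ (ι → β)) (x : α × α) (i : ι) :
    pairEquiv e x i = (e x.1 i, e x.2 i) := rfl

variable [Fintype ι]

/-- The tensor product of the operators `A i`, where `e` decomposes the indices. -/
def tensor (e : α ≃ (ι → β)) (A : ι → Matrix β β ℂ) : Matrix α α ℂ :=
  Matrix.of fun x y => ∏ i, A i (e x i) (e y i)

theorem tensor_apply (e : α ≃ (ι → β)) (A : ι → Matrix β β ℂ) (x y : α) :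
    tensor e A x y = ∏ i, A i (e x i) (e y i) := rfl

theorem tensor_mul [DecidableEq ι] [Fintype α] [Fintype β] (e : α ≃ (ι → β))
    (A B : ι → Matrix β β ℂ) :
    tensor e A * tensor e B = tensor e fun i => A i * B i := by
  ext x y
  simp only [Matrix.mul_apply, tensor_apply, ← Finset.prod_mul_distrib]
  rw [Finset.prod_univ_sum, Fintype.piFinset_univ,
    e.sum_comp fun z : ι → β => ∏ i, A i (e x i) (z i) * B i (z i) (e y i)]

theorem tensor_conjTranspose (e : α ≃ (ι → β)) (A : ι → Matrix β β ℂ) :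
    (tensor e A)ᴴ = tensor e fun i => (A i)ᴴ := by
  ext x y
  simp only [Matrix.conjTranspose_apply, tensor_apply, star_prod]

theorem tensor_one [DecidableEq α] [DecidableEq β] (e : α ≃ (ι → β)) :
    tensor e (fun _ => 1) = 1 := by
  ext x y
  simp only [tensor_apply, Matrix.one_apply]
  by_cases h : x = y
  · simp [h]
  · rw [if_neg h]
    have : e x ≠ e y := fun h' => h (e.injective h')
    obtain ⟨i, hi⟩ := Function.ne_iff.mp this
    exact Finset.prod_eq_zero (Finset.mem_univ i) (if_neg hi)

theorem tensor_kronecker (e : α ≃ (ι → β)) (A B : ι → Matrix β β ℂ) :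
    tensor e A ⊗ₖ tensor e B = tensor (pairEquiv e) fun i => A i ⊗ₖ B i := by
  ext x y
  simp only [Matrix.kroneckerMap_apply, tensor_apply, pairEquiv_apply, Finset.prod_mul_distrib]

theorem conjPair_tensor [DecidableEq ι] [Fintype α] [Fintype β] (e : α ≃ (ι → β))
    (A : ι → Matrix β β ℂ) (O : ι → Matrix (β × β) (β × β) ℂ) :
    conjPair (tensor e A) (tensor (pairEquiv e) O) =
      tensor (pairEquiv e) fun i => conjPair (A i) (O i) := by
  simp only [conjPair, tensor_kronecker, tensor_conjTranspose, tensor_mul]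

theorem tensor_update_add [DecidableEq ι] (e : α ≃ (ι → β)) (A : ι → Matrix β β ℂ) (i : ι)
    (a b : ℂ) (P Q : Matrix β β ℂ) :
    tensor e (Function.update A i (a • P + b • Q)) =
      a • tensor e (Function.update A i P) + b • tensor e (Function.update A i Q) := by
  ext x y
  simp only [Matrix.add_apply, Matrix.smul_apply, tensor_apply, smul_eq_mul]
  simp only [← Finset.mul_prod_erase _ _ (Finset.mem_univ i), Function.update_self]
  have : ∀ R, ∏ j ∈ Finset.univ.erase i, Function.update A i R j (e x j) (e y j) =
      ∏ j ∈ Finset.univ.erase i, A j (e x j) (e y j) := fun R =>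
    Finset.prod_congr rfl fun j hj => by rw [Function.update_of_ne (Finset.ne_of_mem_erase hj)]
  simp only [this, Matrix.add_apply, Matrix.smul_apply, smul_eq_mul]
  ring

end Tensor

/-! ### Pairing the ring into gates -/

section Sites

/-- The qubits on which gate `i` of layer `t` acts. -/
def gateSite (n t : ℕ) (a : Fin (n / 2) × Fin 2) : ZMod n :=
  ((2 * (a.1 : ℕ) + (a.2 : ℕ) + t % 2 : ℕ) : ZMod n)

/-- The shift `t % 2` cancels modulo `n`, and `2 i + b < n` determines `i` and `b`. Evenness of `n`
makes the pairs exhaust the ring. -/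
theorem gateSite_bijective {n : ℕ} [NeZero n] (hn : Even n) (t : ℕ) :
    Function.Bijective (gateSite n t) := by
  rw [Fintype.bijective_iff_injective_and_card]
  constructor
  · rintro ⟨⟨i, hi⟩, ⟨b, hb⟩⟩ ⟨⟨j, hj⟩, ⟨c, hc⟩⟩ h
    have h1 := (ZMod.natCast_eq_natCast_iff _ _ _).mp h
    have h2 := Nat.ModEq.add_right_cancel' _ h1
    have h3 := Nat.ModEq.eq_of_lt_of_lt h2 (by dsimp only; omega) (by dsimp only; omega)
    dsimp only at h3
    simp only [Prod.mk.injEq, Fin.mk.injEq]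
    omega
  · rw [ZMod.card, Fintype.card_prod, Fintype.card_fin, Fintype.card_fin]
    exact Nat.div_mul_cancel hn.two_dvd

/-- The qubits of the ring, sorted by the gates of layer `t`. -/
def siteEquiv {n : ℕ} [NeZero n] (hn : Even n) (t : ℕ) : Fin (n / 2) × Fin 2 ≃ ZMod n :=
  Equiv.ofBijective _ (gateSite_bijective hn t)

theorem siteEquiv_zero {n : ℕ} [NeZero n] (hn : Even n) (t : ℕ) (i : Fin (n / 2)) :
    siteEquiv hn t (i, 0) = gateQubit n t i := by
  simp [siteEquiv, gateSite, gateQubit]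

theorem siteEquiv_one {n : ℕ} [NeZero n] (hn : Even n) (t : ℕ) (i : Fin (n / 2)) :
    siteEquiv hn t (i, 1) = gateQubit n t i + 1 := by
  simp [siteEquiv, gateSite, gateQubit]
  ring

theorem prod_eq_prod_gates {n : ℕ} [NeZero n] (hn : Even n) (t : ℕ) (f : ZMod n → ℂ) :
    ∏ k, f k = ∏ i, f (gateQubit n t i) * f (gateQubit n t i + 1) := by
  rw [← (siteEquiv hn t).prod_comp, Fintype.prod_prod_type]
  exact Finset.prod_congr rfl fun i _ => by
    rw [Fin.prod_univ_two, siteEquiv_zero, siteEquiv_one]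

theorem exists_gate {n : ℕ} [NeZero n] (hn : Even n) (t : ℕ) (x : ZMod n) :
    ∃ i, x = gateQubit n t i ∨ x = gateQubit n t i + 1 := by
  obtain ⟨⟨i, b⟩, rfl⟩ := (siteEquiv hn t).surjective x
  refine ⟨i, ?_⟩
  fin_cases b
  · exact Or.inl (siteEquiv_zero hn t i)
  · exact Or.inr (siteEquiv_one hn t i)

theorem gateQubit_injective {n : ℕ} [NeZero n] (hn : Even n) (t : ℕ) :
    Function.Injective (gateQubit n t) := by
  intro i j h
  rw [← siteEquiv_zero hn, ← siteEquiv_zero hn] at h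
  exact congrArg Prod.fst ((siteEquiv hn t).injective h)

/-- The basis states of the ring, sorted by the gates of layer `t`. -/
def configEquiv {n : ℕ} [NeZero n] (hn : Even n) (t : ℕ) : Config n ≃ (Fin (n / 2) → TwoQubit) :=
  ((Equiv.arrowCongr (siteEquiv hn t).symm (Equiv.refl (Fin 2))).trans
    (Equiv.curry (Fin (n / 2)) (Fin 2) (Fin 2))).trans
      (Equiv.piCongrRight fun _ => finTwoArrowEquiv (Fin 2))

theorem configEquiv_apply {n : ℕ} [NeZero n] (hn : Even n) (t : ℕ) (x : Config n)
    (i : Fin (n / 2)) :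
    configEquiv hn t x i = (x (gateQubit n t i), x (gateQubit n t i + 1)) := by
  rw [← siteEquiv_one hn, ← siteEquiv_zero hn]
  rfl

theorem layer_eq_tensor {n : ℕ} [NeZero n] (hn : Even n) (t : ℕ) (U : Fin (n / 2) → Gate) :
    layer n t U = tensor (configEquiv hn t) fun i => (U i : Matrix TwoQubit TwoQubit ℂ) := by
  ext x y
  simp only [layer, tensor_apply, configEquiv_apply]

theorem layer_conjTranspose_mul_self {n : ℕ} [NeZero n] (hn : Even n) (t : ℕ)
    (U : Fin (n / 2) → Gate) : (layer n t U)ᴴ * layer n t U = 1 := by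
  rw [layer_eq_tensor hn, tensor_conjTranspose, tensor_mul, ← tensor_one (configEquiv hn t)]
  congr 1
  funext i
  exact Matrix.mem_unitaryGroup_iff'.mp (U i).2

end Sites

/-! ### Averaging over the last layer -/

section Average

instance rqc.instIsProbabilityMeasure (n l : ℕ) : IsProbabilityMeasure (rqc n l) := by
  unfold rqc
  infer_instance

theorem continuous_layer (n t : ℕ) : Continuous (layer n t) := by
  refine continuous_matrix fun x y => continuous_finsetProd _ fun i _ => ?_
  exact (continuous_gate_apply _ _).comp (continuous_apply i)

theorem continuous_circuit (n : ℕ) [NeZero n] (l : ℕ) : Continuous (circuit n l) := by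
  induction l with
  | zero => exact continuous_const
  | succ l ih =>
    refine ((continuous_layer n l).comp (continuous_apply _)).matrix_mul (ih.comp ?_)
    exact continuous_pi fun t => continuous_apply _

theorem continuous_conjPair {ι : Type*} [Fintype ι] (X : Matrix (ι × ι) (ι × ι) ℂ) :
    Continuous fun U : Matrix ι ι ℂ => conjPair U X := by
  refine continuous_matrix fun a b => ?_
  simp only [conjPair_apply]
  refine continuous_finsetSum _ fun c _ => continuous_finsetSum _ fun d _ => ?_
  have h : ∀ i j : ι, Continuous fun U : Matrix ι ι ℂ => U i j :=
    fun i j => continuous_id.matrix_elem i j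
  exact ((((h _ _).mul (h _ _)).star.mul continuous_const).mul ((h _ _).mul (h _ _)))

/-- The last layer of a random circuit is independent of the others. -/
theorem integral_rqc_succ {E : Type*} [NormedAddCommGroup E] [NormedSpace ℝ E] (n l : ℕ)
    (g : (Fin (n / 2) → Gate) → Gates n l → E) :
    ∫ U, g (U (Fin.last l)) (fun t => U t.castSucc) ∂(rqc n (l + 1)) =
      ∫ p, g p.1 p.2 ∂((Measure.pi fun _ : Fin (n / 2) => haarGate).prod (rqc n l)) := by
  have h := measurePreserving_piFinSuccAbove
    (fun _ : Fin (l + 1) => Measure.pi fun _ : Fin (n / 2) => haarGate) (Fin.last l)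
  have h' := h.integral_comp' (g := fun p => g p.1 p.2)
  rw [rqc, rqc, ← h']
  simp [MeasurableEquiv.piFinSuccAbove, Fin.insertNthEquiv]
  rfl

/-- The expectation of an observable `X` on two copies of the output state of a random circuit. -/
def pairAverage (n : ℕ) [NeZero n] (l : ℕ)
    (X : Matrix (Config n × Config n) (Config n × Config n) ℂ) : ℂ :=
  ∫ U, conjPair (circuit n l U) X 0 0 ∂(rqc n l)

theorem integrable_conjPair_circuit (n : ℕ) [NeZero n] (l : ℕ)
    (X : Matrix (Config n × Config n) (Config n × Config n) ℂ) :
    Integrable (fun U => conjPair (circuit n l U) X 0 0) (rqc n l) :=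
  ((continuous_conjPair X).comp (continuous_circuit n l)).matrix_elem 0 0
    |>.integrable_of_compactSpace

theorem pairAverage_add (n : ℕ) [NeZero n] (l : ℕ)
    (X Y : Matrix (Config n × Config n) (Config n × Config n) ℂ) :
    pairAverage n l (X + Y) = pairAverage n l X + pairAverage n l Y := by
  rw [pairAverage, pairAverage, pairAverage, ← integral_add
    (integrable_conjPair_circuit n l X) (integrable_conjPair_circuit n l Y)]
  simp only [conjPair, mul_add, add_mul, Matrix.add_apply]

theorem pairAverage_smul (n : ℕ) [NeZero n] (l : ℕ) (a : ℂ)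
    (X : Matrix (Config n × Config n) (Config n × Config n) ℂ) :
    pairAverage n l (a • X) = a * pairAverage n l X := by
  rw [pairAverage, pairAverage, ← integral_const_mul]
  simp only [conjPair, mul_smul_comm, smul_mul_assoc, Matrix.smul_apply, smul_eq_mul]

/-- Averaging over the last layer replaces each factor of a product observable by its twirl. -/
theorem pairAverage_succ {n : ℕ} [NeZero n] (hn : Even n) (l : ℕ) (O : Fin (n / 2) → PairOp) :
    pairAverage n (l + 1) (tensor (pairEquiv (configEquiv hn l)) O) =
      pairAverage n l (tensor (pairEquiv (configEquiv hn l)) fun i => twirl (O i)) := by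
  set T := tensor (pairEquiv (configEquiv hn l))
  have hlayer : ∀ W : Fin (n / 2) → Gate, conjPair (layer n l W) (T O) =
      T fun i => conjPair (W i : Matrix TwoQubit TwoQubit ℂ) (O i) := by
    intro W
    rw [layer_eq_tensor hn]
    exact conjPair_tensor _ _ _
  have hcont : Continuous fun p : (Fin (n / 2) → Gate) × Gates n l =>
      conjPair (circuit n l p.2) (conjPair (layer n l p.1) (T O)) 0 0 := by
    simp only [← conjPair_mul]
    exact ((continuous_conjPair _).comp (((continuous_layer n l).comp continuous_fst).matrix_mul
      ((continuous_circuit n l).comp continuous_snd))).matrix_elem 0 0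
  have hentry : ∀ c d, Integrable (fun W : Fin (n / 2) → Gate => conjPair (layer n l W) (T O) c d)
      (Measure.pi fun _ => haarGate) := fun c d =>
    (((continuous_conjPair _).comp (continuous_layer n l)).matrix_elem c d).integrable_of_compactSpace
  -- Gates in a layer are independent, so the mean of the product is the product of the means.
  have hmean : ∀ c d, ∫ W : Fin (n / 2) → Gate, conjPair (layer n l W) (T O) c d
      ∂(Measure.pi fun _ => haarGate) = T (fun i => twirl (O i)) c d := by
    intro c d
    simp only [hlayer, T, tensor_apply, twirl, Matrix.of_apply]
    exact integral_fintype_prod_eq_prod fun i (U : Gate) =>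
      conjPair (U : Matrix TwoQubit TwoQubit ℂ) (O i) _ _
  calc pairAverage n (l + 1) (T O)
      = ∫ p, conjPair (circuit n l p.2) (conjPair (layer n l p.1) (T O)) 0 0
          ∂((Measure.pi fun _ : Fin (n / 2) => haarGate).prod (rqc n l)) := by
        rw [← integral_rqc_succ n l fun W V =>
          conjPair (circuit n l V) (conjPair (layer n l W) (T O)) 0 0]
        simp only [pairAverage, circuit, conjPair_mul]
    _ = ∫ V, ∫ W, conjPair (circuit n l V) (conjPair (layer n l W) (T O)) 0 0
          ∂(Measure.pi fun _ : Fin (n / 2) => haarGate) ∂(rqc n l) :=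
        integral_prod_symm _ hcont.integrable_of_compactSpace
    _ = pairAverage n l (T fun i => twirl (O i)) := by
        refine integral_congr_ae (Filter.Eventually.of_forall fun V => ?_)
        simp only [conjPair_apply (circuit n l V), ← hmean]
        rw [integral_finsetSum _ fun c _ => integrable_finsetSum _ fun d _ =>
          ((hentry c d).const_mul _).mul_const _]
        refine Finset.sum_congr rfl fun c _ => ?_
        rw [integral_finsetSum _ fun d _ => ((hentry c d).const_mul _).mul_const _]
        refine Finset.sum_congr rfl fun d _ => ?_
        rw [integral_mul_const, integral_const_mul]

end Average

/-! ### Partial swaps and their twirls -/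

section Swap

/-- The swap of two copies of a qubit, or the identity. -/
def qubitSwap (b : Bool) : Matrix (Fin 2 × Fin 2) (Fin 2 × Fin 2) ℂ :=
  Matrix.of fun x y => if x = (if b then y.swap else y) then 1 else 0

/-- The operator that swaps two copies of those of two qubits that are selected. -/
def gateSwap (b b' : Bool) : PairOp := Matrix.of fun x y =>
  qubitSwap b (x.1.1, x.2.1) (y.1.1, y.2.1) * qubitSwap b' (x.1.2, x.2.2) (y.1.2, y.2.2)

/-- The operator that swaps two copies of the qubits in `J`. -/
def swapOn {n : ℕ} [NeZero n] (J : ZMod n → Bool) :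
    Matrix (Config n × Config n) (Config n × Config n) ℂ :=
  Matrix.of fun x y => ∏ k, qubitSwap (J k) (x.1 k, x.2 k) (y.1 k, y.2 k)

theorem gateSwap_apply (b b' : Bool) (x y : TwoQubit × TwoQubit) :
    gateSwap b b' x y = if ((x.1.1, x.2.1) = if b then (y.2.1, y.1.1) else (y.1.1, y.2.1)) ∧
      ((x.1.2, x.2.2) = if b' then (y.2.2, y.1.2) else (y.1.2, y.2.2)) then 1 else 0 := by
  simp only [gateSwap, qubitSwap, Matrix.of_apply, Prod.swap_prod_mk, ite_and, mul_ite, mul_one,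
    mul_zero]
  split_ifs <;> rfl

theorem gateSwap_false_false : gateSwap false false = 1 := by
  ext ⟨⟨a, b⟩, c, d⟩ ⟨⟨a', b'⟩, c', d'⟩
  rw [gateSwap_apply, Matrix.one_apply]
  exact if_congr (by simp; tauto) rfl rfl

theorem gateSwap_true_true : gateSwap true true = swapOp := by
  ext ⟨⟨a, b⟩, c, d⟩ ⟨⟨a', b'⟩, c', d'⟩
  rw [gateSwap_apply, swapOp, Matrix.of_apply]
  exact if_congr (by simp; tauto) rfl rfl

theorem swapOp_mul_gateSwap (b b' : Bool) : swapOp * gateSwap b b' = gateSwap (!b) (!b') := by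
  ext ⟨⟨a, c⟩, d, e⟩ ⟨⟨a', c'⟩, d', e'⟩
  rw [swapOp_mul_apply, gateSwap_apply, gateSwap_apply]
  refine if_congr ?_ rfl rfl
  cases b <;> cases b' <;> simp <;> tauto

theorem trace_gateSwap (b b' : Bool) :
    (gateSwap b b').trace = (if b then 2 else 4) * (if b' then 2 else 4) := by
  simp only [Matrix.trace, Matrix.diag_apply, gateSwap_apply, Finset.sum_boole]
  cases b <;> cases b'
  · rw [show Finset.card _ = 16 by decide]; norm_num
  · rw [show Finset.card _ = 8 by decide]; norm_num
  · rw [show Finset.card _ = 8 by decide]; norm_num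
  · rw [show Finset.card _ = 4 by decide]; norm_num

theorem twirl_gateSwap_self (b : Bool) : twirl (gateSwap b b) = gateSwap b b := by
  rw [twirl_eq, swapOp_mul_gateSwap, trace_gateSwap, trace_gateSwap]
  cases b
  · norm_num [gateSwap_false_false]
  · norm_num [gateSwap_true_true]

/-- Swapping one qubit of the gate gives trace 8, and so does its product with `S`, so both
coefficients are `(4 * 8 - 8) / 60`. -/
theorem twirl_gateSwap_not (b : Bool) :
    twirl (gateSwap b (!b)) =
      (2 / 5 : ℂ) • gateSwap false false + (2 / 5 : ℂ) • gateSwap true true := by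
  rw [twirl_eq, swapOp_mul_gateSwap, trace_gateSwap, trace_gateSwap, gateSwap_false_false,
    gateSwap_true_true]
  cases b <;> norm_num

theorem swapOn_eq_tensor {n : ℕ} [NeZero n] (hn : Even n) (t : ℕ) (J : ZMod n → Bool) :
    swapOn J = tensor (pairEquiv (configEquiv hn t)) fun i =>
      gateSwap (J (gateQubit n t i)) (J (gateQubit n t i + 1)) := by
  ext x y
  rw [swapOn, Matrix.of_apply, prod_eq_prod_gates hn t, tensor_apply]
  simp only [pairEquiv_apply, configEquiv_apply, gateSwap, Matrix.of_apply]

theorem pairAverage_zero_swapOn {n : ℕ} [NeZero n] (J : ZMod n → Bool) :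
    pairAverage n 0 (swapOn J) = 1 := by
  have h : swapOn J (0 : Config n × Config n) 0 = 1 := by
    rw [swapOn, Matrix.of_apply]
    refine Finset.prod_eq_one fun k _ => ?_
    simp [qubitSwap]
  simp [pairAverage, circuit, conjPair, h]

theorem pairAverage_swapOn_const {n : ℕ} [NeZero n] (hn : Even n) (b : Bool) (l : ℕ) :
    pairAverage n l (swapOn fun _ => b) = 1 := by
  induction l with
  | zero => exact pairAverage_zero_swapOn _
  | succ l ih =>
    rw [← ih, swapOn_eq_tensor hn l, pairAverage_succ]
    simp only [twirl_gateSwap_self]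

end Swap

/-! ### Parity and arithmetic on the even ring -/

section Parity

/-- The parity of a position on a ring of even length. -/
def ringParity {n : ℕ} (hn : Even n) : ZMod n →+* ZMod 2 := ZMod.castHom hn.two_dvd (ZMod 2)

theorem ringParity_gateQubit {n : ℕ} (hn : Even n) (t : ℕ) (i : Fin (n / 2)) :
    ringParity hn (gateQubit n t i) = t := by
  have h2 : ringParity hn 2 = 0 := (map_ofNat _ 2).trans rfl
  simp [gateQubit, h2]

theorem exists_gateQubit_eq {n : ℕ} [NeZero n] (hn : Even n) {t : ℕ} {x : ZMod n}
    (hx : ringParity hn x = t) : ∃ i, gateQubit n t i = x := by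
  obtain ⟨i, rfl | rfl⟩ := exists_gate hn t x
  · exact ⟨i, rfl⟩
  · rw [map_add, map_one, ringParity_gateQubit] at hx
    simp at hx

theorem ringParity_eq_val {n : ℕ} [NeZero n] (hn : Even n) (x : ZMod n) :
    ringParity hn x = (x.val : ZMod 2) := by
  conv_lhs => rw [← ZMod.natCast_zmod_val x]
  rw [map_natCast]

theorem odd_val_of_ringParity {n : ℕ} [NeZero n] (hn : Even n) {x : ZMod n}
    (hx : ringParity hn x = 1) : x.val % 2 = 1 := by
  rw [ringParity_eq_val, ← Nat.cast_one, ZMod.natCast_eq_natCast_iff] at hx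
  exact hx

theorem val_add_one_eq {n : ℕ} [NeZero n] (hn : Even n) (x : ZMod n) :
    (x + 1).val = if x.val + 1 = n then 0 else x.val + 1 := by
  have h0 := NeZero.pos n
  have hlt := x.val_lt
  have h1 : (1 : ZMod n).val = 1 := by
    rw [ZMod.val_one_eq_one_mod, Nat.mod_eq_of_lt]
    have := hn.two_dvd
    omega
  rw [ZMod.val_add, h1]
  split_ifs with h
  · rw [h, Nat.mod_self]
  · exact Nat.mod_eq_of_lt (by omega)

theorem val_sub_one_eq {n : ℕ} [NeZero n] (hn : Even n) (x : ZMod n) :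
    (x - 1).val = if x.val = 0 then n - 1 else x.val - 1 := by
  have h := val_add_one_eq hn (x - 1)
  have hlt := (x - 1).val_lt
  rw [sub_add_cancel] at h
  split_ifs at h ⊢ <;> omega

end Parity

/-! ### One step of the arc recursion -/

section Arc

/-- The arc of `2 * k` consecutive qubits that starts at `s`. -/
def arc {n : ℕ} (s : ZMod n) (k : ℕ) : ZMod n → Bool := fun x => decide ((x - s).val < 2 * k)

theorem arc_zero {n : ℕ} (s : ZMod n) : arc s 0 = fun _ => false := by
  funext x
  simp [arc]

theorem arc_half {n : ℕ} [NeZero n] (hn : Even n) (s : ZMod n) :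
    arc s (n / 2) = fun _ => true := by
  funext x
  have := (x - s).val_lt
  simpa [arc, Nat.mul_div_cancel' hn.two_dvd] using this

/-- A product observable that swaps both qubits of a gate or none, and agrees with the swap of an
arc away from two gates. -/
theorem tensor_update_eq_swapOn {n : ℕ} [NeZero n] (hn : Even n) (t : ℕ) (J J' : ZMod n → Bool)
    (i₁ i₂ : Fin (n / 2)) (b₁ b₂ : Bool) (hi : i₁ ≠ i₂)
    (h₁ : J' (gateQubit n t i₁) = b₁ ∧ J' (gateQubit n t i₁ + 1) = b₁)
    (h₂ : J' (gateQubit n t i₂) = b₂ ∧ J' (gateQubit n t i₂ + 1) = b₂)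
    (h : ∀ i, i ≠ i₁ → i ≠ i₂ → J' (gateQubit n t i) = J (gateQubit n t i) ∧
      J' (gateQubit n t i + 1) = J (gateQubit n t i + 1)) :
    tensor (pairEquiv (configEquiv hn t)) (Function.update (Function.update
      (fun i => gateSwap (J (gateQubit n t i)) (J (gateQubit n t i + 1))) i₁ (gateSwap b₁ b₁))
        i₂ (gateSwap b₂ b₂)) = swapOn J' := by
  rw [swapOn_eq_tensor hn t]
  congr 1
  funext i
  by_cases e₂ : i = i₂
  · subst e₂
    rw [Function.update_self, h₂.1, h₂.2]
  · rw [Function.update_of_ne e₂]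
    by_cases e₁ : i = i₁
    · subst e₁
      rw [Function.update_self, h₁.1, h₁.2]
    · rw [Function.update_of_ne e₁, (h i e₁ e₂).1, (h i e₁ e₂).2]

theorem pairAverage_tensor_update_add {n : ℕ} [NeZero n] (hn : Even n) (l t : ℕ)
    (A : Fin (n / 2) → PairOp) (i : Fin (n / 2)) (a b : ℂ) (P Q : PairOp) :
    pairAverage n l (tensor (pairEquiv (configEquiv hn t))
        (Function.update A i (a • P + b • Q))) =
      a * pairAverage n l (tensor (pairEquiv (configEquiv hn t)) (Function.update A i P)) +
      b * pairAverage n l (tensor (pairEquiv (configEquiv hn t)) (Function.update A i Q)) := by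
  rw [tensor_update_add, pairAverage_add, pairAverage_smul, pairAverage_smul]

/-- The parity of `s` is opposite to that of the first qubits of the gates in layer `l`, so exactly
two gates are cut, one at each end. All others are swapped entirely or not at all and are fixed by
the twirl. Each cut gate contributes `2/5 (1 + S)`, giving four arcs of weight `(2/5)²`. -/
theorem pairAverage_succ_arc {n : ℕ} [NeZero n] (hn : Even n) (l k : ℕ) (s : ZMod n)
    (hs : ringParity hn s = ((l + 1 : ℕ) : ZMod 2)) (hk : 0 < k) (hk' : k < n / 2) :
    pairAverage n (l + 1) (swapOn (arc s k)) = 4 / 25 *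
      (pairAverage n l (swapOn (arc (s - 1) (k + 1))) + pairAverage n l (swapOn (arc (s - 1) k)) +
        pairAverage n l (swapOn (arc (s + 1) k)) +
        pairAverage n l (swapOn (arc (s + 1) (k - 1)))) := by
  have hn2 := Nat.mul_div_cancel' hn.two_dvd
  have z2 : (2 : ZMod 2) = 0 := rfl
  -- `i₁` acts on `s - 1, s`; `i₂` acts on `s + 2k - 1, s + 2k`.
  obtain ⟨i₁, hi₁⟩ := exists_gateQubit_eq hn (t := l) (x := s - 1) (by simp [hs])
  obtain ⟨i₂, hi₂⟩ := exists_gateQubit_eq hn (t := l) (x := s + ((2 * k - 1 : ℕ) : ZMod n)) (by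
    rw [map_add, hs, map_natCast, Nat.cast_sub (by omega)]
    push_cast
    rw [z2]
    ring)
  have v₁ : (gateQubit n l i₁ - s).val = n - 1 := by
    rw [hi₁, show s - 1 - s = 0 - 1 by ring, val_sub_one_eq hn, ZMod.val_zero, if_pos rfl]
  have v₂ : (gateQubit n l i₂ - s).val = 2 * k - 1 := by
    rw [hi₂, add_sub_cancel_left, ZMod.val_natCast, Nat.mod_eq_of_lt (by omega)]
  -- Gates start at odd offsets from `s`, so no gate other than `i₁` and `i₂` can meet the boundary
  -- of the arc.
  have hodd : ∀ i, (gateQubit n l i - s).val % 2 = 1 := fun i => by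
    refine odd_val_of_ringParity hn ?_
    rw [map_sub, ringParity_gateQubit, hs]
    push_cast
    rw [sub_add_cancel_left]
    rfl
  have hne : ∀ i j, i ≠ j → (gateQubit n l i - s).val ≠ (gateQubit n l j - s).val := by
    intro i j hij h
    exact hij (gateQubit_injective hn l (sub_left_injective (ZMod.val_injective n h)))
  have hi : i₁ ≠ i₂ := by
    rintro rfl
    omega
  have e1 : ∀ x : ZMod n, x - (s + 1) = x - s - 1 := fun x => by ring
  have e2 : ∀ x : ZMod n, x - (s - 1) = x - s + 1 := fun x => by ring
  have e3 : ∀ x : ZMod n, x + 1 - s = x - s + 1 := fun x => by ring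
  have hB : (fun i => twirl (gateSwap (arc s k (gateQubit n l i)) (arc s k (gateQubit n l i + 1)))) =
      Function.update (Function.update
        (fun i => gateSwap (arc s k (gateQubit n l i)) (arc s k (gateQubit n l i + 1)))
        i₁ ((2 / 5 : ℂ) • gateSwap false false + (2 / 5 : ℂ) • gateSwap true true))
        i₂ ((2 / 5 : ℂ) • gateSwap false false + (2 / 5 : ℂ) • gateSwap true true) := by
    funext i
    by_cases h₂ : i = i₂
    · subst h₂
      rw [Function.update_self, ← twirl_gateSwap_not true]
      congr 2
      · simp only [arc, v₂, decide_eq_true_eq]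
        omega
      · simp only [arc, e3, val_add_one_eq hn, v₂, Bool.not_true, decide_eq_false_iff_not]
        split_ifs <;> omega
    · rw [Function.update_of_ne h₂]
      by_cases h₁ : i = i₁
      · subst h₁
        rw [Function.update_self, ← twirl_gateSwap_not false]
        congr 2
        · simp only [arc, v₁, decide_eq_false_iff_not]
          omega
        · simp only [arc, e3, val_add_one_eq hn, v₁, Bool.not_false, decide_eq_true_eq]
          split_ifs <;> omega
      · rw [Function.update_of_ne h₁]
        have : arc s k (gateQubit n l i + 1) = arc s k (gateQubit n l i) := by
          have g0 := hodd i
          have g1 := hne i i₁ h₁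
          have g2 := hne i i₂ h₂
          have g3 := (gateQubit n l i - s).val_lt
          simp only [arc, e3, val_add_one_eq hn, decide_eq_decide]
          split_ifs <;> omega
        rw [this, twirl_gateSwap_self]
  -- `b₁` and `b₂` tell whether a cut gate is absorbed or released. Each end then moves by one site,
  -- so `2 k' = 2 k + (2 b₁ - 1) + (2 b₂ - 1)`.
  have hterm : ∀ (b₁ b₂ : Bool) (s' : ZMod n) (k' : ℕ),
      s' = (if b₁ then s - 1 else s + 1) →
      k' + 1 = k + (if b₁ then 1 else 0) + (if b₂ then 1 else 0) →
      tensor (pairEquiv (configEquiv hn l)) (Function.update (Function.update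
        (fun i => gateSwap (arc s k (gateQubit n l i)) (arc s k (gateQubit n l i + 1)))
        i₁ (gateSwap b₁ b₁)) i₂ (gateSwap b₂ b₂)) = swapOn (arc s' k') := by
    intro b₁ b₂ s' k' hs' hk'
    refine tensor_update_eq_swapOn hn l _ _ i₁ i₂ b₁ b₂ hi ?_ ?_ ?_
    · cases b₁ <;> cases b₂ <;> simp at hs' hk' <;> subst hs' <;>
        simp only [arc, e1, e2, e3, val_add_one_eq hn, val_sub_one_eq hn, v₁, decide_eq_true_eq,
          decide_eq_false_iff_not, add_sub_cancel_right] <;> split_ifs <;> omega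
    · cases b₁ <;> cases b₂ <;> simp at hs' hk' <;> subst hs' <;>
        simp only [arc, e1, e2, e3, val_add_one_eq hn, val_sub_one_eq hn, v₂, decide_eq_true_eq,
          decide_eq_false_iff_not, add_sub_cancel_right] <;> split_ifs <;> omega
    · intro i h₁ h₂
      have g0 := hodd i
      have g1 := hne i i₁ h₁
      have g2 := hne i i₂ h₂
      have g3 := (gateQubit n l i - s).val_lt
      cases b₁ <;> cases b₂ <;> simp at hs' hk' <;> subst hs' <;>
        simp only [arc, e1, e2, e3, val_add_one_eq hn, val_sub_one_eq hn, decide_eq_decide,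
          add_sub_cancel_right] <;> split_ifs <;> omega
  -- Multilinear expansion acts on the outermost update, so the two updates are exchanged to expand
  -- at `i₁` and then exchanged back.
  rw [swapOn_eq_tensor hn l, pairAverage_succ, hB, pairAverage_tensor_update_add,
    Function.update_comm hi, Function.update_comm hi, pairAverage_tensor_update_add,
    pairAverage_tensor_update_add, Function.update_comm hi.symm, Function.update_comm hi.symm,
    Function.update_comm hi.symm, Function.update_comm hi.symm,
    hterm false false (s + 1) (k - 1) rfl (by simp; omega), hterm true false (s - 1) k rfl (by simp),
    hterm false true (s + 1) k rfl (by simp), hterm true true (s - 1) (k + 1) rfl (by simp)]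
  ring

end Arc

/-! ### Contraction of the purity recursion to its Haar value -/

section ArcPurity

/-- The mean purity, after `l` layers, of an arc of `2 * k` qubits on a ring of `2 * m` qubits. -/
def arcPurity (m : ℕ) : ℕ → ℕ → ℝ
  | 0, _ => 1
  | l + 1, k => if k = 0 ∨ k = m then 1 else
      4 / 25 * (arcPurity m l (k + 1) + 2 * arcPurity m l k + arcPurity m l (k - 1))

/-- Moving an endpoint by one site flips its parity, as does removing a layer, so the recursion
keeps applying, and only the length of the arc matters. -/
theorem pairAverage_arc {n : ℕ} [NeZero n] (hn : Even n) (l : ℕ) : ∀ (k : ℕ) (s : ZMod n),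
    ringParity hn s = (l : ZMod 2) → k ≤ n / 2 →
      pairAverage n l (swapOn (arc s k)) = arcPurity (n / 2) l k := by
  induction l with
  | zero => intro k s _ _; simp [pairAverage_zero_swapOn, arcPurity]
  | succ l ih =>
    intro k s hs hk
    rw [arcPurity]
    split_ifs with h
    · obtain rfl | rfl := h
      · rw [arc_zero, pairAverage_swapOn_const hn, Complex.ofReal_one]
      · rw [arc_half hn, pairAverage_swapOn_const hn, Complex.ofReal_one]
    · have z2 : (1 : ZMod 2) + 1 = 0 := rfl
      have p₁ : ringParity hn (s - 1) = l := by simp [hs]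
      have p₂ : ringParity hn (s + 1) = l := by simp [hs, add_assoc, z2]
      rw [pairAverage_succ_arc hn l k s hs (by omega) (by omega), ih _ _ p₁ (by omega),
        ih _ _ p₁ (by omega), ih _ _ p₂ (by omega), ih _ _ p₂ (by omega)]
      push_cast
      ring

/-- The mean purity of an arc of `2 * k` qubits in a Haar random state of `2 * m` qubits. -/
def haarPurity (m k : ℕ) : ℝ := (4 ^ k + 4 ^ (m - k)) / (4 ^ m + 1)

theorem haarPurity_le_one {m k : ℕ} (hk : k ≤ m) : haarPurity m k ≤ 1 := by
  rw [haarPurity, div_le_one (by positivity)]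
  have h1 : (1 : ℝ) ≤ 4 ^ k := one_le_pow₀ (by norm_num)
  have h2 : (1 : ℝ) ≤ 4 ^ (m - k) := one_le_pow₀ (by norm_num)
  have h3 : (4 : ℝ) ^ m = 4 ^ k * 4 ^ (m - k) := by rw [← pow_add, Nat.add_sub_cancel' hk]
  nlinarith

/-- Both `4^k` and `4^(m - k)` solve the recursion, since `4/25 * (4 + 2 + 1/4) = 1`. -/
theorem haarPurity_recursion {m k : ℕ} (hk : 0 < k) (hkm : k < m) :
    haarPurity m k =
      4 / 25 * (haarPurity m (k + 1) + 2 * haarPurity m k + haarPurity m (k - 1)) := by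
  obtain ⟨j, rfl⟩ : ∃ j, k = j + 1 := ⟨k - 1, by omega⟩
  obtain ⟨r, rfl⟩ : ∃ r, m = j + 2 + r := ⟨m - (j + 2), by omega⟩
  rw [haarPurity, haarPurity, haarPurity, show j + 2 + r - (j + 1) = r + 1 by omega,
    show j + 2 + r - (j + 1 + 1) = r by omega, show j + 2 + r - (j + 1 - 1) = r + 2 by omega,
    Nat.add_sub_cancel]
  have : (4 : ℝ) ^ (j + 2 + r) + 1 ≠ 0 := by positivity
  field_simp
  ring

/-- The difference obeys the same linear recursion with zero boundary values. Its weights are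
nonnegative with sum `16/25`, and it starts in `[0, 1]`. -/
theorem arcPurity_sub_haarPurity (m l : ℕ) : ∀ k ≤ m,
    0 ≤ arcPurity m l k - haarPurity m k ∧
      arcPurity m l k - haarPurity m k ≤ (16 / 25 : ℝ) ^ l := by
  induction l with
  | zero =>
    intro k hk
    have h1 := haarPurity_le_one hk
    have h2 : 0 ≤ haarPurity m k := by unfold haarPurity; positivity
    rw [arcPurity, pow_zero]
    constructor <;> linarith
  | succ l ih =>
    intro k hk
    rw [arcPurity]
    split_ifs with h
    · have : haarPurity m k = 1 := by
        have : (4 : ℝ) ^ m + 1 ≠ 0 := by positivity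
        rw [haarPurity, div_eq_one_iff_eq this]
        obtain rfl | rfl := h
        · rw [pow_zero, Nat.sub_zero, add_comm]
        · rw [Nat.sub_self, pow_zero]
      rw [this, sub_self]
      exact ⟨le_rfl, by positivity⟩
    · have h1 := ih (k + 1) (by omega)
      have h2 := ih k hk
      have h3 := ih (k - 1) (by omega)
      have h4 := haarPurity_recursion (m := m) (k := k) (by omega) (by omega)
      rw [pow_succ]
      constructor <;> linarith [h1.1, h1.2, h2.1, h2.2, h3.1, h3.2]

end ArcPurity

/-! ### Two copies of a Pauli operator -/

section PauliAverage

theorem Pauli.conjTranspose_toMatrix (p : Pauli) : p.toMatrixᴴ = p.toMatrix := by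
  cases p <;> ext i j <;> fin_cases i <;> fin_cases j <;> simp [Pauli.toMatrix]

theorem Pauli.toMatrix_mul_self (p : Pauli) : p.toMatrix * p.toMatrix = 1 := by
  cases p <;> ext i j <;> fin_cases i <;> fin_cases j <;>
    simp [Pauli.toMatrix, Matrix.mul_apply, Fin.sum_univ_two]

theorem Pauli.trace_toMatrix {p : Pauli} (hp : p ≠ Pauli.I) : p.toMatrix.trace = 0 := by
  cases p <;> simp_all [Pauli.toMatrix, Matrix.trace]

theorem Pauli.toMatrix_I : Pauli.I.toMatrix = 1 := by
  ext i j
  fin_cases i <;> fin_cases j <;> simp [Pauli.toMatrix]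

/-- Two copies of a two-qubit Pauli operator. -/
def pauliPair (p p' : Pauli) : PairOp :=
  (p.toMatrix ⊗ₖ p'.toMatrix) ⊗ₖ (p.toMatrix ⊗ₖ p'.toMatrix)

theorem pauliPair_I_I : pauliPair Pauli.I Pauli.I = gateSwap false false := by
  rw [pauliPair, Pauli.toMatrix_I, Matrix.one_kronecker_one, Matrix.one_kronecker_one,
    gateSwap_false_false]

theorem trace_swapOp_mul_kronecker (A : Matrix TwoQubit TwoQubit ℂ) :
    (swapOp * (A ⊗ₖ A)).trace = (A * A).trace := by
  simp only [Matrix.trace, Matrix.diag_apply, swapOp_mul_apply, Matrix.kroneckerMap_apply]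
  rw [Fintype.sum_prod_type]
  refine Finset.sum_congr rfl fun a _ => ?_
  rw [Matrix.mul_apply]
  exact Finset.sum_congr rfl fun b _ => mul_comm _ _

/-- A nontrivial Pauli pair `P` is traceless with `P² = 1`, so `tr (P ⊗ P) = 0` and `tr (S (P ⊗ P))
= tr 1 = 4`. -/
theorem twirl_pauliPair {p p' : Pauli} (h : ¬ (p = Pauli.I ∧ p' = Pauli.I)) :
    twirl (pauliPair p p') =
      (-1 / 15 : ℂ) • gateSwap false false + (4 / 15 : ℂ) • gateSwap true true := by
  have h1 : (pauliPair p p').trace = 0 := by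
    rw [pauliPair, Matrix.trace_kronecker, Matrix.trace_kronecker]
    by_cases hp : p = Pauli.I
    · rw [Pauli.trace_toMatrix fun hp' => h ⟨hp, hp'⟩]
      simp
    · rw [Pauli.trace_toMatrix hp]
      simp
  have h2 : (swapOp * pauliPair p p').trace = 4 := by
    rw [pauliPair, trace_swapOp_mul_kronecker, ← Matrix.mul_kronecker_mul,
      Pauli.toMatrix_mul_self, Pauli.toMatrix_mul_self, Matrix.trace_kronecker]
    norm_num [Matrix.trace_one]
  rw [twirl_eq, h1, h2, gateSwap_false_false, gateSwap_true_true]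
  norm_num

theorem pauliOperator_eq_tensor {n : ℕ} [NeZero n] (hn : Even n) (t : ℕ) (p : ZMod n → Pauli) :
    pauliOperator n p = tensor (configEquiv hn t) fun i =>
      (p (gateQubit n t i)).toMatrix ⊗ₖ (p (gateQubit n t i + 1)).toMatrix := by
  ext x y
  rw [pauliOperator, prod_eq_prod_gates hn t, tensor_apply]
  simp only [configEquiv_apply, Matrix.kroneckerMap_apply]

theorem pauliOperator_kronecker_eq_tensor {n : ℕ} [NeZero n] (hn : Even n) (t : ℕ)
    (p : ZMod n → Pauli) :
    pauliOperator n p ⊗ₖ pauliOperator n p = tensor (pairEquiv (configEquiv hn t)) fun i =>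
      pauliPair (p (gateQubit n t i)) (p (gateQubit n t i + 1)) := by
  rw [pauliOperator_eq_tensor hn t, tensor_kronecker]
  rfl

theorem conjTranspose_pauliOperator (n : ℕ) [NeZero n] (p : ZMod n → Pauli) :
    (pauliOperator n p)ᴴ = pauliOperator n p := by
  ext x y
  simp only [Matrix.conjTranspose_apply, pauliOperator, star_prod]
  exact Finset.prod_congr rfl fun k _ => by
    rw [← Matrix.conjTranspose_apply, Pauli.conjTranspose_toMatrix]

/-- `C† σ_p C` is Hermitian, so its diagonal entry is real and the squared modulus is a plain
square, an entry of the two-copy operator. -/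
theorem pauliSq_eq_conjPair (n : ℕ) [NeZero n] (p : ZMod n → Pauli) (l : ℕ) (U : Gates n l) :
    (pauliSq n p l U : ℂ) =
      conjPair (circuit n l U) (pauliOperator n p ⊗ₖ pauliOperator n p) 0 0 := by
  set A := (circuit n l U)ᴴ * pauliOperator n p * circuit n l U with hA
  have hherm : Aᴴ = A := by
    rw [hA, Matrix.conjTranspose_mul, Matrix.conjTranspose_mul, Matrix.conjTranspose_conjTranspose,
      conjTranspose_pauliOperator, Matrix.mul_assoc]
  have hstar : star (A 0 0) = A 0 0 := by
    rw [← Matrix.conjTranspose_apply, hherm]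
  have h1 : conjPair (circuit n l U) (pauliOperator n p ⊗ₖ pauliOperator n p) = A ⊗ₖ A := by
    rw [conjPair, Matrix.conjTranspose_kronecker, ← Matrix.mul_kronecker_mul,
      ← Matrix.mul_kronecker_mul]
  rw [h1, Matrix.kroneckerMap_apply, pauliSq, ← hA, Complex.ofReal_pow, ← Complex.mul_conj']
  change A 0 0 * star (A 0 0) = _
  rw [hstar]
  rfl

theorem integral_pauliSq (n : ℕ) [NeZero n] (p : ZMod n → Pauli) (l : ℕ) :
    ((∫ U, pauliSq n p l U ∂(rqc n l) : ℝ) : ℂ) =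
      pairAverage n l (pauliOperator n p ⊗ₖ pauliOperator n p) := by
  rw [pairAverage, ← integral_complex_ofReal]
  simp only [pauliSq_eq_conjPair]

theorem integral_pauliSq_succ {n : ℕ} [NeZero n] (hn : Even n) (p : ZMod n → Pauli) (l : ℕ) :
    ((∫ U, pauliSq n p (l + 1) U ∂(rqc n (l + 1)) : ℝ) : ℂ) =
      pairAverage n l (tensor (pairEquiv (configEquiv hn l)) fun i =>
        twirl (pauliPair (p (gateQubit n l i)) (p (gateQubit n l i + 1)))) := by
  rw [integral_pauliSq, pauliOperator_kronecker_eq_tensor hn l, pairAverage_succ]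

end PauliAverage

/-! ### From the Pauli error to arcs of two and four qubits -/

section LastLayer

/-- An arc of even length starting at a gate is a union of whole gates. -/
theorem arc_gateQubit_add_one {n : ℕ} [NeZero n] (hn : Even n) (t k : ℕ) (i j : Fin (n / 2)) :
    arc (gateQubit n t i) k (gateQubit n t j + 1) = arc (gateQubit n t i) k (gateQubit n t j) := by
  have hn2 := Nat.mul_div_cancel' hn.two_dvd
  have e : gateQubit n t j + 1 - gateQubit n t i = gateQubit n t j - gateQubit n t i + 1 := by ring
  have heven : (gateQubit n t j - gateQubit n t i + 1).val % 2 = 1 := by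
    refine odd_val_of_ringParity hn ?_
    simp [ringParity_gateQubit]
  have hlt := (gateQubit n t j - gateQubit n t i).val_lt
  rw [val_add_one_eq hn] at heven
  simp only [arc, e, val_add_one_eq hn, decide_eq_decide]
  split_ifs at heven ⊢
  omega

theorem arc_one_gateQubit {n : ℕ} [NeZero n] (hn : Even n) (t : ℕ) (i j : Fin (n / 2)) :
    arc (gateQubit n t i) 1 (gateQubit n t j) = decide (j = i) := by
  have h := arc_gateQubit_add_one hn t 1 i j
  have hlt := (gateQubit n t j - gateQubit n t i).val_lt
  have e : gateQubit n t j + 1 - gateQubit n t i = gateQubit n t j - gateQubit n t i + 1 := by ring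
  have heq : j = i ↔ (gateQubit n t j - gateQubit n t i).val = 0 := by
    rw [ZMod.val_eq_zero, sub_eq_zero, (gateQubit_injective hn t).eq_iff]
  simp only [arc, e, val_add_one_eq hn, decide_eq_decide, heq] at h ⊢
  split_ifs at h <;> omega

theorem arc_two_gateQubit {n : ℕ} [NeZero n] (hn : Even n) (t : ℕ) (i i' j : Fin (n / 2))
    (hi : i ≠ i') (h : gateQubit n t i' = gateQubit n t i + 2) :
    arc (gateQubit n t i) 2 (gateQubit n t j) = decide (j = i ∨ j = i') := by
  have hn2 := Nat.mul_div_cancel' hn.two_dvd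
  have hn4 : 4 ≤ n := by
    by_contra hlt
    apply hi
    have h1 := i.2
    have h2 := i'.2
    ext
    omega
  have h1 := arc_one_gateQubit hn t i j
  have h2 := arc_one_gateQubit hn t i' j
  have e : gateQubit n t j - (gateQubit n t i + 2) = gateQubit n t j - gateQubit n t i - 1 - 1 := by
    ring
  have hlt := (gateQubit n t j - gateQubit n t i).val_lt
  simp only [arc, h, e, val_sub_one_eq hn, decide_eq_decide] at h1 h2 ⊢
  rw [← h1, ← h2]
  split_ifs <;> omega

/-- The value for a Pauli operator on which exactly one gate of the last layer acts. -/
theorem integral_pauliSq_one_gate {n : ℕ} [NeZero n] (hn : Even n) (p : ZMod n → Pauli) (l : ℕ)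
    (i : Fin (n / 2))
    (hi : ¬ (p (gateQubit n l i) = Pauli.I ∧ p (gateQubit n l i + 1) = Pauli.I))
    (h : ∀ j, j ≠ i → p (gateQubit n l j) = Pauli.I ∧ p (gateQubit n l j + 1) = Pauli.I) :
    ∫ U, pauliSq n p (l + 1) U ∂(rqc n (l + 1)) = (4 * arcPurity (n / 2) l 1 - 1) / 15 := by
  have hpos := i.pos
  have hT : (fun j => twirl (pauliPair (p (gateQubit n l j)) (p (gateQubit n l j + 1)))) =
      Function.update (fun _ => gateSwap false false) i
        ((-1 / 15 : ℂ) • gateSwap false false + (4 / 15 : ℂ) • gateSwap true true) := by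
    funext j
    by_cases hj : j = i
    · subst hj
      rw [Function.update_self, twirl_pauliPair hi]
    · rw [Function.update_of_ne hj, (h j hj).1, (h j hj).2, pauliPair_I_I, twirl_gateSwap_self]
  have h0 : tensor (pairEquiv (configEquiv hn l)) (Function.update
      (fun _ => gateSwap false false) i (gateSwap false false)) = swapOn fun _ => false := by
    rw [swapOn_eq_tensor hn l, Function.update_eq_self i fun _ => gateSwap false false]
  have h1 : tensor (pairEquiv (configEquiv hn l)) (Function.update
      (fun _ => gateSwap false false) i (gateSwap true true)) =
        swapOn (arc (gateQubit n l i) 1) := by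
    rw [swapOn_eq_tensor hn l]
    congr 1
    funext j
    rw [arc_gateQubit_add_one hn, arc_one_gateQubit hn]
    by_cases hj : j = i
    · subst hj
      simp
    · simp [hj]
  have key := integral_pauliSq_succ hn p l
  rw [hT, pairAverage_tensor_update_add, h0, h1, pairAverage_swapOn_const hn,
    pairAverage_arc hn l 1 _ (ringParity_gateQubit hn l i) hpos] at key
  apply Complex.ofReal_injective
  rw [key]
  push_cast
  ring

/-- The value for a Pauli operator on which exactly two adjacent gates of the last layer act. -/
theorem integral_pauliSq_two_gates {n : ℕ} [NeZero n] (hn : Even n) (p : ZMod n → Pauli) (l : ℕ)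
    (i i' : Fin (n / 2)) (hii : i ≠ i') (hadj : gateQubit n l i' = gateQubit n l i + 2)
    (hi : ¬ (p (gateQubit n l i) = Pauli.I ∧ p (gateQubit n l i + 1) = Pauli.I))
    (hi' : ¬ (p (gateQubit n l i') = Pauli.I ∧ p (gateQubit n l i' + 1) = Pauli.I))
    (h : ∀ j, j ≠ i → j ≠ i' →
      p (gateQubit n l j) = Pauli.I ∧ p (gateQubit n l j + 1) = Pauli.I) :
    ∫ U, pauliSq n p (l + 1) U ∂(rqc n (l + 1)) =
      (1 - 8 * arcPurity (n / 2) l 1 + 16 * arcPurity (n / 2) l 2) / 225 := by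
  have hpos := i.pos
  have hm : 2 ≤ n / 2 := by
    by_contra hlt
    apply hii
    have h1 := i.2
    have h2 := i'.2
    ext
    omega
  have hT : (fun j => twirl (pauliPair (p (gateQubit n l j)) (p (gateQubit n l j + 1)))) =
      Function.update (Function.update (fun _ => gateSwap false false) i
        ((-1 / 15 : ℂ) • gateSwap false false + (4 / 15 : ℂ) • gateSwap true true)) i'
        ((-1 / 15 : ℂ) • gateSwap false false + (4 / 15 : ℂ) • gateSwap true true) := by
    funext j
    by_cases hj' : j = i'
    · subst hj'
      rw [Function.update_self, twirl_pauliPair hi']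
    · rw [Function.update_of_ne hj']
      by_cases hj : j = i
      · subst hj
        rw [Function.update_self, twirl_pauliPair hi]
      · rw [Function.update_of_ne hj, (h j hj hj').1, (h j hj hj').2, pauliPair_I_I,
          twirl_gateSwap_self]
  have hterm : ∀ (b b' : Bool) (J : ZMod n → Bool),
      (∀ j, J (gateQubit n l j) = (decide (j = i) && b || decide (j = i') && b')) →
      (∀ j, J (gateQubit n l j + 1) = J (gateQubit n l j)) →
      tensor (pairEquiv (configEquiv hn l)) (Function.update (Function.update
        (fun _ => gateSwap false false) i (gateSwap b b)) i' (gateSwap b' b')) = swapOn J := by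
    intro b b' J h1 h2
    refine tensor_update_eq_swapOn hn l (fun _ => false) J i i' b b' hii ?_ ?_ ?_
    · simp [h1, h2, hii]
    · simp [h1, h2, hii.symm]
    · intro j hj hj'
      simp [h1, h2, hj, hj']
  have key := integral_pauliSq_succ hn p l
  rw [hT, pairAverage_tensor_update_add,
    Function.update_comm hii, Function.update_comm hii, pairAverage_tensor_update_add,
    pairAverage_tensor_update_add, Function.update_comm hii.symm, Function.update_comm hii.symm,
    Function.update_comm hii.symm, Function.update_comm hii.symm,
    hterm false false (fun _ => false) (by simp) (by simp),
    hterm true false (arc (gateQubit n l i) 1) (by simp [arc_one_gateQubit hn])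
      (arc_gateQubit_add_one hn l 1 i),
    hterm false true (arc (gateQubit n l i') 1) (by simp [arc_one_gateQubit hn])
      (arc_gateQubit_add_one hn l 1 i'),
    hterm true true (arc (gateQubit n l i) 2) (by simp [arc_two_gateQubit hn l i i' _ hii hadj])
      (arc_gateQubit_add_one hn l 2 i),
    pairAverage_swapOn_const hn,
    pairAverage_arc hn l 1 _ (ringParity_gateQubit hn l i) hpos,
    pairAverage_arc hn l 1 _ (ringParity_gateQubit hn l i') hpos,
    pairAverage_arc hn l 2 _ (ringParity_gateQubit hn l i) hm] at key
  apply Complex.ofReal_injective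
  rw [key]
  push_cast
  ring

/-- At the Haar purity the left side is exactly `1 / (4^m + 1)`; the deviation enters with factor
`4/15`. -/
theorem one_gate_bound {m : ℕ} (hm : 1 ≤ m) (l : ℕ) :
    (4 * arcPurity m l 1 - 1) / 15 ≤ 4 / 15 * (16 / 25 : ℝ) ^ l + 1 / (4 ^ m + 1) := by
  have h := (arcPurity_sub_haarPurity m l 1 hm).2
  have h1 : (4 * haarPurity m 1 - 1) / 15 = 1 / (4 ^ m + 1) := by
    obtain ⟨r, rfl⟩ : ∃ r, m = r + 1 := ⟨m - 1, by omega⟩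
    rw [haarPurity, Nat.add_sub_cancel]
    have : (4 : ℝ) ^ (r + 1) + 1 ≠ 0 := by positivity
    field_simp
    ring
  linarith

/-- The purity at `k = 1` has a negative coefficient, so its nonnegative deviation is dropped; the
one at `k = 2` costs `16/225 ≤ 4/15`. -/
theorem two_gates_bound {m : ℕ} (hm : 2 ≤ m) (l : ℕ) :
    (1 - 8 * arcPurity m l 1 + 16 * arcPurity m l 2) / 225 ≤
      4 / 15 * (16 / 25 : ℝ) ^ l + 1 / (4 ^ m + 1) := by
  have h := (arcPurity_sub_haarPurity m l 1 (by omega)).1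
  have h' := (arcPurity_sub_haarPurity m l 2 hm).2
  have h0 : 0 ≤ (16 / 25 : ℝ) ^ l := by positivity
  have h1 : (1 - 8 * haarPurity m 1 + 16 * haarPurity m 2) / 225 = 1 / (4 ^ m + 1) := by
    obtain ⟨r, rfl⟩ : ∃ r, m = r + 2 := ⟨m - 2, by omega⟩
    rw [haarPurity, haarPurity, Nat.add_sub_cancel, show r + 2 - 1 = r + 1 by omega]
    have : (4 : ℝ) ^ (r + 2) + 1 ≠ 0 := by positivity
    field_simp
    ring
  linarith

/-- Three consecutive qubits are covered by two adjacent gates. -/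
theorem exists_gates_of_isLocalPauli {n : ℕ} [NeZero n] (hn : Even n) (t : ℕ)
    {p : ZMod n → Pauli} (hp : IsLocalPauli 3 p) :
    ∃ i i' : Fin (n / 2), gateQubit n t i' = gateQubit n t i + 2 ∧
      ∀ j, j ≠ i → j ≠ i' →
        p (gateQubit n t j) = Pauli.I ∧ p (gateQubit n t j + 1) = Pauli.I := by
  obtain ⟨q, hq⟩ := hp
  obtain ⟨i, hi⟩ := exists_gate hn t q
  obtain ⟨i', hi'⟩ := exists_gateQubit_eq hn (t := t) (x := gateQubit n t i + 2) (by
    rw [map_add, ringParity_gateQubit, map_ofNat, show (2 : ZMod 2) = 0 from rfl, add_zero])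
  refine ⟨i, i', hi', fun j hj hj' => ?_⟩
  have hsite : ∀ (c : Fin 2) (r : Fin (n / 2)) (b : Fin 2), j ≠ r →
      siteEquiv hn t (j, c) ≠ siteEquiv hn t (r, b) := fun c r b hjr h =>
    hjr (congrArg Prod.fst ((siteEquiv hn t).injective h))
  have hmain : ∀ c : Fin 2, p (siteEquiv hn t (j, c)) = Pauli.I := by
    intro c
    by_contra hI
    obtain ⟨r, hr, h⟩ := hq _ hI
    have a0 := hsite c i 0 hj
    have a1 := hsite c i 1 hj
    have b0 := hsite c i' 0 hj'
    have b1 := hsite c i' 1 hj'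
    rw [siteEquiv_zero] at a0 b0
    rw [siteEquiv_one] at a1 b1
    rw [hi'] at b0 b1
    rw [h] at a0 a1 b0 b1
    -- If `q` is the first qubit of gate `i`, the window takes the first three of the four covered
    -- qubits; otherwise the last three.
    obtain rfl | rfl := hi
    · interval_cases r
      · exact a0 (by simp)
      · exact a1 (by simp)
      · exact b0 (by simp)
    · interval_cases r
      · exact a1 (by simp)
      · exact b0 (by push_cast; ring)
      · exact b1 (by push_cast; ring)
  exact ⟨siteEquiv_zero hn t j ▸ hmain 0, siteEquiv_one hn t j ▸ hmain 1⟩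

/-- The second moment of the expectation of a nontrivial `3`-local Pauli operator. -/
theorem integral_pauliSq_le {n : ℕ} [NeZero n] (hn : Even n) {p : ZMod n → Pauli}
    (hp : p ≠ fun _ => Pauli.I) (hloc : IsLocalPauli 3 p) (l : ℕ) :
    ∫ U, pauliSq n p (l + 1) U ∂(rqc n (l + 1)) ≤
      4 / 15 * (16 / 25 : ℝ) ^ l + 1 / (2 ^ n + 1) := by
  have h4 : (2 : ℝ) ^ n = 4 ^ (n / 2) := by
    rw [show (4 : ℝ) = 2 ^ 2 by norm_num, ← pow_mul, Nat.mul_div_cancel' hn.two_dvd]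
  rw [h4]
  obtain ⟨i, i', hadj, h⟩ := exists_gates_of_isLocalPauli hn l hloc
  have hm : 1 ≤ n / 2 := i.pos
  by_cases hi : p (gateQubit n l i) = Pauli.I ∧ p (gateQubit n l i + 1) = Pauli.I
  · by_cases hi' : p (gateQubit n l i') = Pauli.I ∧ p (gateQubit n l i' + 1) = Pauli.I
    · exfalso
      apply hp
      funext x
      obtain ⟨j, hx⟩ := exists_gate hn l x
      have hj : p (gateQubit n l j) = Pauli.I ∧ p (gateQubit n l j + 1) = Pauli.I := by
        by_cases e : j = i
        · exact e ▸ hi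
        · by_cases e' : j = i'
          · exact e' ▸ hi'
          · exact h j e e'
      obtain rfl | rfl := hx
      · exact hj.1
      · exact hj.2
    · rw [integral_pauliSq_one_gate hn p l i' hi' fun j hj => by
        by_cases e : j = i
        · exact e ▸ hi
        · exact h j e hj]
      exact one_gate_bound hm l
  -- The case `i = i'` is the ring of two qubits, where `+ 2` returns to the same gate.
  · by_cases hi' : i = i' ∨ p (gateQubit n l i') = Pauli.I ∧ p (gateQubit n l i' + 1) = Pauli.I
    · rw [integral_pauliSq_one_gate hn p l i hi fun j hj => by
        by_cases e : j = i'
        · exact e ▸ hi'.resolve_left fun h' => hj (e.trans h'.symm)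
        · exact h j hj e]
      exact one_gate_bound hm l
    · rw [not_or] at hi'
      rw [integral_pauliSq_two_gates hn p l i i' hi'.1 hadj hi hi'.2 h]
      refine two_gates_bound ?_ l
      by_contra hlt
      apply hi'.1
      have h1 := i.2
      have h2 := i'.2
      ext
      omega

end LastLayer

/-! ### Reducing the overlap to the layers before the error -/

section Overlap

theorem erroneousCircuit_of_lt (n : ℕ) [NeZero n] (p : ZMod n → Pauli) (l d : ℕ) (h : d < l)
    (U : Gates n d) : erroneousCircuit n p l d U = circuit n d U := by
  induction d with
  | zero => rfl
  | succ d ih =>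
    rcases Nat.lt_or_ge (d + 1) l with h' | h'
    · rw [erroneousCircuit, circuit, ih (by omega), if_neg (by omega), one_mul]
    · omega

theorem erroneousCircuit_self (n : ℕ) [NeZero n] (p : ZMod n → Pauli) (l : ℕ)
    (U : Gates n (l + 1)) :
    erroneousCircuit n p (l + 1) (l + 1) U = pauliOperator n p * circuit n (l + 1) U := by
  rw [erroneousCircuit, if_pos rfl, erroneousCircuit_of_lt n p _ _ (Nat.lt_succ_self l), circuit]

theorem overlapSq_eq (n : ℕ) [NeZero n] (p : ZMod n → Pauli) (d l : ℕ) (U : Gates n d) :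
    overlapSq n p d l U = ‖((erroneousCircuit n p l d U)ᴴ * circuit n d U) 0 0‖ ^ 2 := rfl

/-- The condition `1 ≤ l` matters: for `l = 0` the recursion never inserts the error. -/
theorem overlapSq_self (n : ℕ) [NeZero n] (p : ZMod n → Pauli) {l : ℕ} (hl : 1 ≤ l)
    (U : Gates n l) : overlapSq n p l l U = pauliSq n p l U := by
  obtain ⟨l, rfl⟩ := Nat.exists_eq_add_of_le' hl
  rw [overlapSq_eq, erroneousCircuit_self, Matrix.conjTranspose_mul, conjTranspose_pauliOperator,
    pauliSq]

/-- A layer after the error stands next to its own adjoint and cancels. -/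
theorem overlapSq_succ {n : ℕ} [NeZero n] (hn : Even n) (p : ZMod n → Pauli) {d l : ℕ}
    (h : l ≤ d) (U : Gates n (d + 1)) :
    overlapSq n p (d + 1) l U = overlapSq n p d l fun t => U t.castSucc := by
  rw [overlapSq_eq, overlapSq_eq, erroneousCircuit, circuit, if_neg (by omega), one_mul,
    Matrix.conjTranspose_mul, Matrix.mul_assoc, ← Matrix.mul_assoc (layer n d _)ᴴ,
    layer_conjTranspose_mul_self hn, one_mul]

theorem continuous_pauliSq (n : ℕ) [NeZero n] (p : ZMod n → Pauli) (l : ℕ) :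
    Continuous (pauliSq n p l) := by
  have h := continuous_circuit n l
  exact ((((h.matrix_conjTranspose).matrix_mul continuous_const).matrix_mul h).matrix_elem
    0 0).norm.pow 2

theorem continuous_overlapSq {n : ℕ} [NeZero n] (hn : Even n) (p : ZMod n → Pauli) {d l : ℕ}
    (hl : 1 ≤ l) (h : l ≤ d) : Continuous (overlapSq n p d l) := by
  induction d, h using Nat.le_induction with
  | base => exact (funext (overlapSq_self n p hl)) ▸ continuous_pauliSq n p l
  | succ d hd ih =>
    rw [funext (overlapSq_succ hn p hd)]
    exact ih.comp (continuous_pi fun t => continuous_apply _)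

theorem integral_overlapSq {n : ℕ} [NeZero n] (hn : Even n) (p : ZMod n → Pauli) {d l : ℕ}
    (hl : 1 ≤ l) (h : l ≤ d) :
    ∫ U, overlapSq n p d l U ∂(rqc n d) = ∫ U, pauliSq n p l U ∂(rqc n l) := by
  induction d, h using Nat.le_induction with
  | base => simp only [overlapSq_self n p hl]
  | succ d hd ih =>
    rw [← ih]
    simp only [overlapSq_succ hn p hd]
    rw [integral_rqc_succ n d fun _ V => overlapSq n p d l V, integral_fun_snd]
    simp

end Overlap

end

theorem mainTheorem2 :
    (∀ (n : ℕ) [NeZero n], Even n → ∀ p : ZMod n → Pauli, ∀ l d : ℕ, 1 ≤ l → l ≤ d →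
      Integrable (pauliSq n p l) (rqc n l) ∧
      Integrable (overlapSq n p d l) (rqc n d) ∧
      ∫ U, overlapSq n p d l U ∂(rqc n d) = ∫ U, pauliSq n p l U ∂(rqc n l)) ∧
    (∃ Δ : ℝ, 0 < Δ ∧
      ∀ (n : ℕ) [NeZero n], Even n → ∀ p : ZMod n → Pauli, p ≠ (fun _ => Pauli.I) →
        IsLocalPauli 3 p → ∀ l : ℕ, 1 ≤ l →
          ∫ U, pauliSq n p l U ∂(rqc n l) ≤ Real.exp (-(Δ * (l : ℝ))) + 1 / (2 : ℝ) ^ n) ∧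
    (∀ (n : ℕ) [NeZero n], Even n → ∀ p : ZMod n → Pauli, p ≠ (fun _ => Pauli.I) →
      IsLocalPauli 1 p → ∀ l : ℕ, 1 ≤ l →
        ∫ U, pauliSq n p l U ∂(rqc n l) ≤
          4 / 15 * (4 / 5 : ℝ) ^ (2 * (l - 1)) + 1 / ((2 : ℝ) ^ n + 1)) := by
  refine ⟨fun n _ hn p l d hl hd => ⟨(continuous_pauliSq n p l).integrable_of_compactSpace,
    (continuous_overlapSq hn p hl hd).integrable_of_compactSpace, integral_overlapSq hn p hl hd⟩,
    -- With this rate `e^(-Δ l) = (16/25)^l`, which dominates `4/15 * (16/25)^(l - 1)` because `4/15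
    -- ≤ 16/25`.
    ⟨Real.log (25 / 16), Real.log_pos (by norm_num), fun n _ hn p hp hloc l hl => ?_⟩,
    fun n _ hn p hp hloc l hl => ?_⟩
  · obtain ⟨l, rfl⟩ := Nat.exists_eq_add_of_le' hl
    refine (integral_pauliSq_le hn hp hloc l).trans (add_le_add ?_ ?_)
    · have hexp : Real.exp (-(Real.log (25 / 16) * ((l + 1 : ℕ) : ℝ))) =
          (16 / 25) ^ l * (16 / 25) := by
        rw [mul_comm, ← mul_neg, ← Real.log_inv, Real.exp_nat_mul, Real.exp_log (by norm_num),
          pow_succ]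
        norm_num
      rw [hexp]
      have : (0 : ℝ) ≤ (16 / 25) ^ l := by positivity
      linarith
    · exact one_div_le_one_div_of_le (by positivity) (by linarith)
  · obtain ⟨l, rfl⟩ := Nat.exists_eq_add_of_le' hl
    obtain ⟨q, hq⟩ := hloc
    have hloc' : IsLocalPauli 3 p := ⟨q, fun j hj => by
      obtain ⟨i, hi, h⟩ := hq j hj
      exact ⟨i, by omega, h⟩⟩
    refine (integral_pauliSq_le hn hp hloc' l).trans_eq ?_
    rw [Nat.add_sub_cancel, pow_mul]
    norm_num
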